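/- Let $n\ge 2$, $0\le\lambda_1,\dots,\lambda_n<\infty$, and let $p,E$ be real-valued $C^\infty$ functions near $0\in\mathbb C^n$ vanishing to order at least $3$ at $0$. Put $q(z,\bar z)=\sum_{i=1}^n\big(|z_i|^2+\lambda_i(z_i^2+\bar z_i^2)\big)$, $G=q+p$, and let $$M=\{(z,w)\in\mathbb C^{n}\times\mathbb C:\ w=q(z,\bar z)+p(z,\bar z)+iE(z,\bar z)\}\qquad(2.1)$$ near $0$, a real submanifold of dimension $2n$. A point $x$ of $M$ is a CR point if $\dim_{\mathbb C}T^{(1,0)}_{x'}M$ is constant for $x'\in M$ near $x$. The manifold $M$ is non-minimal at a CR point $x$ if it contains a CR submanifold $S\ni x$ with $\dim_{\mathbb R}S<2n$ and $T^{(1,0)}_xS=T^{(1,0)}_xM$. Subscripts $\alpha,\bar\alpha$ on functions of $z$ denote $\partial/\partial z_\alpha,\partial/\partial\bar z_\alpha$. For $1\le j,k\le n-1$ let $A=G_n-iE_n$, $B_{(j)}=G_j-iE_j$, $C_{(j)}=2i(G_nE_j-G_jE_n)$, $$L_j=A\frac{\partial}{\partial z_j}-B_{(j)}\frac{\partial}{\partial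 z_n}+C_{(j)}\frac{\partial}{\partial w},\qquad T=[L_1,\bar L_1].$$ Let $\lambda_{(1jk)},\dots,\lambda_{(6jk)}$ be the coefficients of $[L_j,\bar L_k]$ with respect to $\frac{\partial}{\partial\bar z_k},\frac{\partial}{\partial\bar z_n},\frac{\partial}{\partial\bar w},\frac{\partial}{\partial z_j},\frac{\partial}{\partial z_n},\frac{\partial}{\partial w}$, that is, $$\lambda_{(1jk)}=A\,\bar A_j-B_{(j)}\bar A_n,\quad \lambda_{(2jk)}=-A(\overline{B_{(k)}})_j+B_{(j)}(\overline{B_{(k)}})_n,\quad \lambda_{(3jk)}=A(\overline{C_{(k)}})_j-B_{(j)}(\overline{C_{(k)}})_n,$$ $$\lambda_{(4jk)}=-\bar A A_{\bar k}+\overline{B_{(k)}}A_{\bar n},\quad \lambda_{(5jk)}=\bar A (B_{(j)})_{\bar k}-\overline{B_{(k)}}(B_{(j)})_{\bar n},\quad \lambda_{(6jk)}=-\bar A (C_{(j)})_{\bar k}+\overline{B_{(k)}}(C_{(j)})_{\bar n}.$$ Likewise let $\Gamma_{(1)},\dots,\Gamma_{(6)}$ be the coefficients of $[L_1,T]$ with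 respect to $\frac{\partial}{\partial\bar z_1},\frac{\partial}{\partial\bar z_n},\frac{\partial}{\partial\bar w},\frac{\partial}{\partial z_1},\frac{\partial}{\partial z_n},\frac{\partial}{\partial w}$; with $D f=A f_1-B_{(1)}f_n$ and $D'f=\lambda_{(111)}f_{\bar 1}+\lambda_{(211)}f_{\bar n}+\lambda_{(411)}f_1+\lambda_{(511)}f_n$ they are $\Gamma_{(i)}=D\lambda_{(i11)}$ for $i=1,2,3$, $\Gamma_{(4)}=D\lambda_{(411)}-D'A$, $\Gamma_{(5)}=D\lambda_{(511)}+D'B_{(1)}$, $\Gamma_{(6)}=D\lambda_{(611)}-D'C_{(1)}$. **Proposition 2.2.** Suppose that $M$ is non-minimal at all its CR points near $0$. Then there are a neighborhood $U$ of $0$ in $\mathbb C^{n+1}$ and a relatively open, dense subset $\mathcal O$ of $M\cap U$ such that at every point of $\mathcal O$ the vectors $[L_j,\bar L_k]$ ($1\le j,k\le n-1$) and $[L_1,T]$ lie in $\operatorname{span}\{L_h,\bar L_h\ (1\le h\le n-1),\,T\}$, and the following linear systems are solvable. For all $1\le j,k\le n-1$, the system with unknown $\gamma$: $$\begin{aligned}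 (\bar A\lambda_{(211)}+\overline{B_{(1)}}\lambda_{(111)})\gamma&=\bar A\lambda_{(2jk)}+\lambda_{(1jk)}\overline{B_{(k)}},& (\bar A\lambda_{(311)}-\overline{C_{(1)}}\lambda_{(111)})\gamma&=\bar A\lambda_{(3jk)}-\lambda_{(1jk)}\overline{C_{(k)}},\\ (A\lambda_{(511)}+B_{(1)}\lambda_{(411)})\gamma&=A\lambda_{(5jk)}+\lambda_{(4jk)}B_{(j)},& (A\lambda_{(611)}-C_{(1)}\lambda_{(411)})\gamma&=A\lambda_{(6jk)}-\lambda_{(4jk)}C_{(j)}; \end{aligned}$$ for all $1\le k\le n-1$, the system with unknown $\hat\gamma$ obtained from it by putting $j=1$; and the system with unknown $\tau$: $$\begin{aligned} (\bar A\lambda_{(211)}+\overline{B_{(1)}}\lambda_{(111)})\tau&=\bar A\Gamma_{(2)}+\Gamma_{(1)}\overline{B_{(1)}},& (\bar A\lambda_{(311)}-\overline{C_{(1)}}\lambda_{(111)})\tau&=\bar A\Gamma_{(3)}-\Gamma_{(1)}\overline{C_{(1)}},\\ (A\lambda_{(511)}+B_{(1)}\lambda_{(411)})\tau&=A\Gamma_{(5)}+\Gamma_{(4)}B_{(1)},&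 (A\lambda_{(611)}-C_{(1)}\lambda_{(411)})\tau&=A\Gamma_{(6)}-\Gamma_{(4)}C_{(1)}. \end{aligned}$$ Moreover, at every point of $M\cap U$, for all $1\le j,k\le n-1$, $$(\bar A\lambda_{(2jk)}+\overline{B_{(k)}}\lambda_{(1jk)})(A\lambda_{(611)}-C_{(1)}\lambda_{(411)})=(\bar A\lambda_{(211)}+\overline{B_{(1)}}\lambda_{(111)})(A\lambda_{(6jk)}-C_{(j)}\lambda_{(4jk)}),$$ $$(\bar A\lambda_{(21k)}+\overline{B_{(k)}}\lambda_{(11k)})(A\lambda_{(611)}-C_{(1)}\lambda_{(411)})=(\bar A\lambda_{(211)}+\overline{B_{(1)}}\lambda_{(111)})(A\lambda_{(61k)}-C_{(1)}\lambda_{(41k)}),$$ $$(\bar A\Gamma_{(2)}+\Gamma_{(1)}\overline{B_{(1)}})(\bar A\lambda_{(311)}-\lambda_{(111)}\overline{C_{(1)}})=(\bar A\Gamma_{(3)}-\Gamma_{(1)}\overline{C_{(1)}})(\bar A\lambda_{(211)}+\lambda_{(111)}\overline{B_{(1)}}).$$ -/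

import Mathlib

open Filter Topology
open scoped ContDiff

noncomputable section

namespace CRFlat

/-! ### Complex vector fields and CR geometry in `ℂ^ι` -/

section General

variable {ι : Type*} [Fintype ι] [DecidableEq ι]

/-- The Wirtinger derivative `∂f/∂z_i = (∂f/∂x_i - √-1 ∂f/∂y_i) / 2`. -/
def dz (i : ι) (f : (ι → ℂ) → ℂ) (x : ι → ℂ) : ℂ :=
  (1 / 2) * (fderiv ℝ f x (Pi.single i 1) - Complex.I * fderiv ℝ f x (Pi.single i Complex.I))

/-- The Wirtinger derivative `∂f/∂z̄_i = (∂f/∂x_i + √-1 ∂f/∂y_i) / 2`. -/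
def dzbar (i : ι) (f : (ι → ℂ) → ℂ) (x : ι → ℂ) : ℂ :=
  (1 / 2) * (fderiv ℝ f x (Pi.single i 1) + Complex.I * fderiv ℝ f x (Pi.single i Complex.I))

/-- A complexified tangent vector `∑ a_i ∂/∂z_i + ∑ b_i ∂/∂z̄_i` of `ℂ^ι`, stored as `(a, b)`. -/
abbrev CVec (ι : Type*) : Type _ := (ι → ℂ) × (ι → ℂ)

/-- The derivative at `x` of the function `f` along the complexified tangent vector `v`. -/
def act (v : CVec ι) (f : (ι → ℂ) → ℂ) (x : ι → ℂ) : ℂ :=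
  ∑ i, v.1 i * dz i f x + ∑ i, v.2 i * dzbar i f x

/-- The complex conjugate of a complex vector field: the conjugate of
`∑ a_i ∂/∂z_i + ∑ b_i ∂/∂z̄_i` is `∑ b̄_i ∂/∂z_i + ∑ ā_i ∂/∂z̄_i`. -/
def conjField (X : (ι → ℂ) → CVec ι) (x : ι → ℂ) : CVec ι :=
  (fun i => starRingEnd ℂ ((X x).2 i), fun i => starRingEnd ℂ ((X x).1 i))

/-- The Lie bracket `[X, Y]` of two complex vector fields: its coefficients are
`X (coefficient of Y) - Y (coefficient of X)`. -/
def bracket (X Y : (ι → ℂ) → CVec ι) (x : ι → ℂ) : CVec ι :=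
  (fun i => act (X x) (fun y => (Y y).1 i) x - act (Y x) (fun y => (X y).1 i) x,
   fun i => act (X x) (fun y => (Y y).2 i) x - act (Y x) (fun y => (X y).2 i) x)

/-- `S` is a smooth embedded real submanifold of `ℂ^ι` of real dimension `k`: near each of its
points it is the zero set of a smooth submersion onto `ℝ^c`, where `k + c = dim_ℝ ℂ^ι`. -/
def IsSmoothSubmanifold (S : Set (ι → ℂ)) (k : ℕ) : Prop :=
  ∀ q ∈ S, ∃ (c : ℕ) (U : Set (ι → ℂ)) (ρ : (ι → ℂ) → (Fin c → ℝ)),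
    k + c = 2 * Fintype.card ι ∧ IsOpen U ∧ q ∈ U ∧ ContDiffOn ℝ ∞ ρ U ∧
    S ∩ U = {x | x ∈ U ∧ ρ x = 0} ∧
    ∀ x ∈ S ∩ U, Function.Surjective (fderiv ℝ ρ x)

/-- The complexified tangent space `ℂ ⊗ T_q S`: the complexified tangent vectors at `q`
annihilating every smooth real function near `q` that vanishes on `S`. -/
def complexTangent (S : Set (ι → ℂ)) (q : ι → ℂ) : Submodule ℂ (CVec ι) where
  carrier := {v | ∀ (U : Set (ι → ℂ)) (f : (ι → ℂ) → ℝ), IsOpen U → q ∈ U → ContDiffOn ℝ ∞ f U →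
    (∀ x ∈ S ∩ U, f x = 0) → act v (fun y => (f y : ℂ)) q = 0}
  add_mem' := by
    intro v w hv hw U f hU hq hf h0
    have h1 := hv U f hU hq hf h0
    have h2 := hw U f hU hq hf h0
    have h3 : act (v + w) (fun y => (f y : ℂ)) q
        = act v (fun y => (f y : ℂ)) q + act w (fun y => (f y : ℂ)) q := by
      simp only [act, Prod.fst_add, Prod.snd_add, Pi.add_apply, add_mul, Finset.sum_add_distrib]
      ring
    rw [h3, h1, h2, add_zero]
  zero_mem' := by
    intro U f _ _ _ _
    simp [act]
  smul_mem' := by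
    intro c v hv U f hU hq hf h0
    have h1 := hv U f hU hq hf h0
    have h3 : act (c • v) (fun y => (f y : ℂ)) q = c * act v (fun y => (f y : ℂ)) q := by
      simp only [act, Prod.smul_fst, Prod.smul_snd, Pi.smul_apply, smul_eq_mul, mul_add,
        Finset.mul_sum, mul_assoc]
    rw [h3, h1, mul_zero]

/-- The space `T^{(1,0)}_q S` of tangent vectors of type `(1,0)`: those of the form
`∑ a_i ∂/∂z_i`. -/
def holTangent (S : Set (ι → ℂ)) (q : ι → ℂ) : Submodule ℂ (CVec ι) :=
  complexTangent S q ⊓ LinearMap.ker (LinearMap.snd ℂ (ι → ℂ) (ι → ℂ))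

/-- The CR dimension of `S` at `q`. -/
def crDim (S : Set (ι → ℂ)) (q : ι → ℂ) : ℕ := Module.finrank ℂ (holTangent S q)

/-- `q` is a CR point of `S`: the CR dimension is constant on `S` near `q`. -/
def IsCRPoint (S : Set (ι → ℂ)) (q : ι → ℂ) : Prop :=
  ∀ᶠ x in 𝓝[S] q, crDim S x = crDim S q

/-- The real submanifold `M` of real dimension `d` is non-minimal at its point `q`: it contains a
CR submanifold `S` of smaller dimension through `q` with `T^{(1,0)}_q S = T^{(1,0)}_q M`. -/
def IsNonminimalAt (M : Set (ι → ℂ)) (d : ℕ) (q : ι → ℂ) : Prop :=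
  ∃ (S : Set (ι → ℂ)) (k : ℕ), k < d ∧ S ⊆ M ∧ q ∈ S ∧ IsSmoothSubmanifold S k ∧
    (∀ x ∈ S, IsCRPoint S x) ∧ holTangent S q = holTangent M q

end General

/-- The function `f` vanishes to order at least `m` at the origin. -/
def OrdGE {n : ℕ} (f : (Fin n → ℂ) → ℝ) (m : ℕ) : Prop :=
  ∀ k < m, iteratedFDeriv ℝ k f 0 = 0

/-! ### The submanifold `w = G + √-1 E` and its vector fields

Here `n = N + 1`. The coordinates of `ℂ^n` are `z_i` for `i : Fin (N + 1)`, and `z_n` is the one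
with index `Fin.last N`; the indices `1 ≤ j ≤ n - 1` are the `j : Fin N`, and `z_j` has index
`j.castSucc`. In `ℂ^{n+1}` the coordinate `w` is the last one. -/

/-- The quadric `q(z, z̄) = ∑ (|z_i|² + μ_i (z_i² + z̄_i²))`. -/
def quadric {n : ℕ} (μ : Fin n → ℝ) (z : Fin n → ℂ) : ℝ :=
  ∑ i, (‖z i‖ ^ 2 + μ i * (z i ^ 2 + (starRingEnd ℂ (z i)) ^ 2).re)

/-- The projection `(z, w) ↦ z`. -/
def zpart {n : ℕ} (x : Fin (n + 1) → ℂ) : Fin n → ℂ := fun i => x i.castSucc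

/-- The submanifold `{(z, w) : z ∈ Ω, w = G(z) + √-1 E(z)}`. -/
def graphSet {n : ℕ} (Ω : Set (Fin n → ℂ)) (G E : (Fin n → ℂ) → ℝ) : Set (Fin (n + 1) → ℂ) :=
  {x | zpart x ∈ Ω ∧ x (Fin.last n) = (G (zpart x) : ℂ) + Complex.I * (E (zpart x) : ℂ)}

section Coefficients

variable {N : ℕ} (G E : (Fin (N + 1) → ℂ) → ℝ)

/-- `∂/∂z_i` of a real-valued function. -/
def rdz {n : ℕ} (i : Fin n) (f : (Fin n → ℂ) → ℝ) (z : Fin n → ℂ) : ℂ :=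
  dz i (fun y => (f y : ℂ)) z

/-- `A = G_n - √-1 E_n`. -/
def cA (z : Fin (N + 1) → ℂ) : ℂ :=
  rdz (Fin.last N) G z - Complex.I * rdz (Fin.last N) E z

/-- `B_(j) = G_j - √-1 E_j`. -/
def cB (j : Fin N) (z : Fin (N + 1) → ℂ) : ℂ :=
  rdz j.castSucc G z - Complex.I * rdz j.castSucc E z

/-- `C_(j) = 2 √-1 (G_n E_j - G_j E_n)`. -/
def cC (j : Fin N) (z : Fin (N + 1) → ℂ) : ℂ :=
  2 * Complex.I * (rdz (Fin.last N) G z * rdz j.castSucc E z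
    - rdz j.castSucc G z * rdz (Fin.last N) E z)

/-- The complex conjugate of `A`. -/
def cAbar (z : Fin (N + 1) → ℂ) : ℂ := starRingEnd ℂ (cA G E z)

/-- The complex conjugate of `B_(j)`. -/
def cBbar (j : Fin N) (z : Fin (N + 1) → ℂ) : ℂ := starRingEnd ℂ (cB G E j z)

/-- The complex conjugate of `C_(j)`. -/
def cCbar (j : Fin N) (z : Fin (N + 1) → ℂ) : ℂ := starRingEnd ℂ (cC G E j z)

/-- The vector field `L_j = A ∂/∂z_j - B_(j) ∂/∂z_n + C_(j) ∂/∂w` on `ℂ^{n+1}`. -/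
def L (j : Fin N) (x : Fin (N + 1 + 1) → ℂ) : CVec (Fin (N + 1 + 1)) :=
  (Pi.single j.castSucc.castSucc (cA G E (zpart x))
    - Pi.single (Fin.last N).castSucc (cB G E j (zpart x))
    + Pi.single (Fin.last (N + 1)) (cC G E j (zpart x)), 0)

/-- The conjugate vector field of `L_j`. -/
def Lbar (j : Fin N) : (Fin (N + 1 + 1) → ℂ) → CVec (Fin (N + 1 + 1)) := conjField (L G E j)

/-- `T = [L_1, L̄_1]`. -/
def T [NeZero N] : (Fin (N + 1 + 1) → ℂ) → CVec (Fin (N + 1 + 1)) :=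
  bracket (L G E 0) (Lbar G E 0)

/-- The span at `x` of the vectors `L_h`, `L̄_h` (`1 ≤ h ≤ n - 1`) and `T`. -/
def spanLT [NeZero N] (x : Fin (N + 1 + 1) → ℂ) : Submodule ℂ (CVec (Fin (N + 1 + 1))) :=
  Submodule.span ℂ
    (Set.range (fun h => L G E h x) ∪ Set.range (fun h => Lbar G E h x) ∪ {T G E x})

/-- The coefficient `λ_(1jk)` of `∂/∂z̄_k` in `[L_j, L̄_k]`. -/
def lam1 (j _k : Fin N) (z : Fin (N + 1) → ℂ) : ℂ :=
  cA G E z * dz j.castSucc (cAbar G E) z - cB G E j z * dz (Fin.last N) (cAbar G E) z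

/-- The coefficient `λ_(2jk)` of `∂/∂z̄_n` in `[L_j, L̄_k]`. -/
def lam2 (j k : Fin N) (z : Fin (N + 1) → ℂ) : ℂ :=
  -(cA G E z * dz j.castSucc (cBbar G E k) z) + cB G E j z * dz (Fin.last N) (cBbar G E k) z

/-- The coefficient `λ_(3jk)` of `∂/∂w̄` in `[L_j, L̄_k]`. -/
def lam3 (j k : Fin N) (z : Fin (N + 1) → ℂ) : ℂ :=
  cA G E z * dz j.castSucc (cCbar G E k) z - cB G E j z * dz (Fin.last N) (cCbar G E k) z

/-- The coefficient `λ_(4jk)` of `∂/∂z_j` in `[L_j, L̄_k]`. -/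
def lam4 (_j k : Fin N) (z : Fin (N + 1) → ℂ) : ℂ :=
  -(cAbar G E z * dzbar k.castSucc (cA G E) z) + cBbar G E k z * dzbar (Fin.last N) (cA G E) z

/-- The coefficient `λ_(5jk)` of `∂/∂z_n` in `[L_j, L̄_k]`. -/
def lam5 (j k : Fin N) (z : Fin (N + 1) → ℂ) : ℂ :=
  cAbar G E z * dzbar k.castSucc (cB G E j) z - cBbar G E k z * dzbar (Fin.last N) (cB G E j) z

/-- The coefficient `λ_(6jk)` of `∂/∂w` in `[L_j, L̄_k]`. -/
def lam6 (j k : Fin N) (z : Fin (N + 1) → ℂ) : ℂ :=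
  -(cAbar G E z * dzbar k.castSucc (cC G E j) z) + cBbar G E k z * dzbar (Fin.last N) (cC G E j) z

variable [NeZero N]

/-- The operator `f ↦ A f_1 - B_(1) f_n`, by which `L_1` acts on functions of `z`. -/
def opL1 (f : (Fin (N + 1) → ℂ) → ℂ) (z : Fin (N + 1) → ℂ) : ℂ :=
  cA G E z * dz (0 : Fin N).castSucc f z - cB G E 0 z * dz (Fin.last N) f z

/-- The operator `f ↦ λ_(111) f_1̄ + λ_(211) f_n̄ + λ_(411) f_1 + λ_(511) f_n`, by which `T` acts on
functions of `z`. -/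
def opT (f : (Fin (N + 1) → ℂ) → ℂ) (z : Fin (N + 1) → ℂ) : ℂ :=
  lam1 G E 0 0 z * dzbar (0 : Fin N).castSucc f z + lam2 G E 0 0 z * dzbar (Fin.last N) f z
    + lam4 G E 0 0 z * dz (0 : Fin N).castSucc f z + lam5 G E 0 0 z * dz (Fin.last N) f z

/-- The coefficient `Γ_(1)` of `∂/∂z̄_1` in `[L_1, T]`. -/
def gam1 (z : Fin (N + 1) → ℂ) : ℂ := opL1 G E (lam1 G E 0 0) z

/-- The coefficient `Γ_(2)` of `∂/∂z̄_n` in `[L_1, T]`. -/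
def gam2 (z : Fin (N + 1) → ℂ) : ℂ := opL1 G E (lam2 G E 0 0) z

/-- The coefficient `Γ_(3)` of `∂/∂w̄` in `[L_1, T]`. -/
def gam3 (z : Fin (N + 1) → ℂ) : ℂ := opL1 G E (lam3 G E 0 0) z

/-- The coefficient `Γ_(4)` of `∂/∂z_1` in `[L_1, T]`. -/
def gam4 (z : Fin (N + 1) → ℂ) : ℂ := opL1 G E (lam4 G E 0 0) z - opT G E (cA G E) z

/-- The coefficient `Γ_(5)` of `∂/∂z_n` in `[L_1, T]`. -/
def gam5 (z : Fin (N + 1) → ℂ) : ℂ := opL1 G E (lam5 G E 0 0) z + opT G E (cB G E 0) z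

/-- The coefficient `Γ_(6)` of `∂/∂w` in `[L_1, T]`. -/
def gam6 (z : Fin (N + 1) → ℂ) : ℂ := opL1 G E (lam6 G E 0 0) z - opT G E (cC G E 0) z

/-- The linear system for `γ` that belongs to `[L_j, L̄_k]`. -/
def SystemGamma (j k : Fin N) (z : Fin (N + 1) → ℂ) (γ : ℂ) : Prop :=
  (cAbar G E z * lam2 G E 0 0 z + cBbar G E 0 z * lam1 G E 0 0 z) * γ
      = cAbar G E z * lam2 G E j k z + lam1 G E j k z * cBbar G E k z ∧
  (cAbar G E z * lam3 G E 0 0 z - cCbar G E 0 z * lam1 G E 0 0 z) * γ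
      = cAbar G E z * lam3 G E j k z - lam1 G E j k z * cCbar G E k z ∧
  (cA G E z * lam5 G E 0 0 z + cB G E 0 z * lam4 G E 0 0 z) * γ
      = cA G E z * lam5 G E j k z + lam4 G E j k z * cB G E j z ∧
  (cA G E z * lam6 G E 0 0 z - cC G E 0 z * lam4 G E 0 0 z) * γ
      = cA G E z * lam6 G E j k z - lam4 G E j k z * cC G E j z

/-- The linear system for `γ̂` that belongs to `[L_1, L̄_k]`. -/
def SystemGammaHat (k : Fin N) (z : Fin (N + 1) → ℂ) (γ : ℂ) : Prop :=
  (cAbar G E z * lam2 G E 0 0 z + lam1 G E 0 0 z * cBbar G E 0 z) * γ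
      = cAbar G E z * lam2 G E 0 k z + lam1 G E 0 k z * cBbar G E k z ∧
  (cAbar G E z * lam3 G E 0 0 z - lam1 G E 0 0 z * cCbar G E 0 z) * γ
      = cAbar G E z * lam3 G E 0 k z - lam1 G E 0 k z * cCbar G E k z ∧
  (cA G E z * lam5 G E 0 0 z + lam4 G E 0 0 z * cB G E 0 z) * γ
      = cA G E z * lam5 G E 0 k z + lam4 G E 0 k z * cB G E 0 z ∧
  (cA G E z * lam6 G E 0 0 z - lam4 G E 0 0 z * cC G E 0 z) * γ
      = cA G E z * lam6 G E 0 k z - lam4 G E 0 k z * cC G E 0 z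

/-- The linear system for `τ` that belongs to `[L_1, T]`. -/
def SystemTau (z : Fin (N + 1) → ℂ) (τ : ℂ) : Prop :=
  (cAbar G E z * lam2 G E 0 0 z + lam1 G E 0 0 z * cBbar G E 0 z) * τ
      = cAbar G E z * gam2 G E z + gam1 G E z * cBbar G E 0 z ∧
  (cAbar G E z * lam3 G E 0 0 z - lam1 G E 0 0 z * cCbar G E 0 z) * τ
      = cAbar G E z * gam3 G E z - gam1 G E z * cCbar G E 0 z ∧
  (cA G E z * lam5 G E 0 0 z + lam4 G E 0 0 z * cB G E 0 z) * τ
      = cA G E z * gam5 G E z + gam4 G E z * cB G E 0 z ∧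
  (cA G E z * lam6 G E 0 0 z - lam4 G E 0 0 z * cC G E 0 z) * τ
      = cA G E z * gam6 G E z - gam4 G E z * cC G E 0 z

/-- The identity obtained by eliminating `γ` for the pair `(j, k)`. -/
def IdentityGamma (j k : Fin N) (z : Fin (N + 1) → ℂ) : Prop :=
  (cAbar G E z * lam2 G E j k z + cBbar G E k z * lam1 G E j k z)
      * (cA G E z * lam6 G E 0 0 z - cC G E 0 z * lam4 G E 0 0 z)
    = (cAbar G E z * lam2 G E 0 0 z + cBbar G E 0 z * lam1 G E 0 0 z)
      * (cA G E z * lam6 G E j k z - cC G E j z * lam4 G E j k z)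

/-- The identity obtained by eliminating `γ̂` for the index `k`. -/
def IdentityGammaHat (k : Fin N) (z : Fin (N + 1) → ℂ) : Prop :=
  (cAbar G E z * lam2 G E 0 k z + cBbar G E k z * lam1 G E 0 k z)
      * (cA G E z * lam6 G E 0 0 z - cC G E 0 z * lam4 G E 0 0 z)
    = (cAbar G E z * lam2 G E 0 0 z + cBbar G E 0 z * lam1 G E 0 0 z)
      * (cA G E z * lam6 G E 0 k z - cC G E 0 z * lam4 G E 0 k z)

/-- The identity obtained by eliminating `τ`. -/
def IdentityTau (z : Fin (N + 1) → ℂ) : Prop :=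
  (cAbar G E z * gam2 G E z + gam1 G E z * cBbar G E 0 z)
      * (cAbar G E z * lam3 G E 0 0 z - lam1 G E 0 0 z * cCbar G E 0 z)
    = (cAbar G E z * gam3 G E z - gam1 G E z * cCbar G E 0 z)
      * (cAbar G E z * lam2 G E 0 0 z + lam1 G E 0 0 z * cBbar G E 0 z)

end Coefficients

end CRFlat

end

/-!
Where `A ≠ 0` the fields `L_1, …, L_{n-1}` form a frame of the `(1,0)`-tangent spaces of `M`
(`holTangent_eq_span`), so these points are CR points (`isCRPoint_graph`) and `M` is non-minimal
there. Let `S ⊆ M` be the corresponding CR submanifold through such a point `x`. The CR dimension of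
`S` is locally constant and at `x` it is that of `M`, hence the `L_j` and their conjugates are
tangent to `S` near `x` (`eventually_L_mem_complexTangent`), and so are all their iterated brackets
(`bracket_mem_complexTangent`). The complexified tangent space of `S` has dimension at most
`2n - 1`.

After `L_1` has been eliminated, `A` times the coefficient of `∂/∂z_n` left in `T` is
`|A|² B_{(1),1̄} - A B̄_(1) B_{(1),n̄} - B_(1) Ā A_1̄ + |B_(1)|² A_n̄`. At the origin the four second
derivatives are `1, 0, 0, 1`, because `p` and `E` vanish to third order and the mixed second
derivatives of `q` are those of `∑ |z_i|²`. Near the origin this coefficient is therefore a small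
perturbation of `|A|² + |B_(1)|²` and does not vanish where `A ≠ 0`
(`exists_nhds_leviCoeff_ne_zero`). There the `2n - 1` vectors `L_h`, `L̄_h`, `T` are linearly
independent and fill the tangent space of `S`, which contains all the brackets
(`bracket_mem_spanLT`). Expanding a bracket in this basis and eliminating the coefficients of `L_h`
and `L̄_h` with linear forms that vanish on these fields gives the linear systems
(`exists_system_of_mem_spanLT`).

Finally `A` does not vanish identically on any open set near the origin, since `A_n̄` is close to `1`
there. So the points with `A ≠ 0` are dense, and the identities, which follow from the systems by
eliminating the unknown, extend to all of `M` near the origin by continuity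
(`identities_of_frequently`).
-/

set_option linter.unusedSectionVars false

namespace CRFlat

/-! ### Calculus of complexified tangent vectors -/

section Calculus

variable {ι κ : Type*} [Fintype ι] [DecidableEq ι] [Fintype κ] [DecidableEq κ]

/-- The real tangent vector `ξ` in the decomposition `v = ξ + √-1 η` of a complexified tangent
vector, where a real vector `ξ` is stored as the pair `(ξ, ξ̄)`. -/
noncomputable def reVec (v : CVec ι) : ι → ℂ := fun i => (v.1 i + starRingEnd ℂ (v.2 i)) / 2

/-- The real tangent vector `η` in the decomposition `v = ξ + √-1 η`. -/
noncomputable def imVec (v : CVec ι) : ι → ℂ :=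
  fun i => -Complex.I * (v.1 i - starRingEnd ℂ (v.2 i)) / 2

theorem clm_apply_eq_sum (D : (ι → ℂ) →L[ℝ] ℂ) (ξ : ι → ℂ) :
    D ξ = ∑ i, ((ξ i).re * D (Pi.single i 1) + (ξ i).im * D (Pi.single i Complex.I)) := by
  have h : ξ = ∑ i, ((ξ i).re • (Pi.single i 1 : ι → ℂ)
      + (ξ i).im • (Pi.single i Complex.I : ι → ℂ)) := by
    ext k
    simp only [Finset.sum_apply, Pi.add_apply, Pi.smul_apply, Finset.sum_add_distrib,
      Pi.single_apply, smul_ite, smul_zero, Finset.sum_ite_eq, Finset.mem_univ, if_true]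
    simp [Complex.re_add_im]
  conv_lhs => rw [h]
  simp [map_sum]

/-- `act` is the complex-linear extension of the real derivative. -/
theorem act_eq (v : CVec ι) (f : (ι → ℂ) → ℂ) (x : ι → ℂ) :
    act v f x = fderiv ℝ f x (reVec v) + Complex.I * fderiv ℝ f x (imVec v) := by
  rw [clm_apply_eq_sum _ (reVec v), clm_apply_eq_sum _ (imVec v), act, Finset.mul_sum,
    ← Finset.sum_add_distrib, ← Finset.sum_add_distrib]
  refine Finset.sum_congr rfl fun i _ => ?_
  simp only [dz, dzbar, reVec, imVec]
  generalize fderiv ℝ f x (Pi.single i 1) = P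
  generalize fderiv ℝ f x (Pi.single i Complex.I) = Q
  generalize v.1 i = a
  generalize v.2 i = b
  have e1 : (((a + starRingEnd ℂ b) / 2).re : ℂ) = (a.re + b.re) / 2 := by simp
  have e2 : (((a + starRingEnd ℂ b) / 2).im : ℂ) = (a.im - b.im) / 2 := by simp; ring
  have e3 : ((-Complex.I * (a - starRingEnd ℂ b) / 2).re : ℂ) = (a.im + b.im) / 2 := by simp
  have e4 : ((-Complex.I * (a - starRingEnd ℂ b) / 2).im : ℂ) = (b.re - a.re) / 2 := by simp
  rw [e1, e2, e3, e4]
  conv_lhs => rw [← Complex.re_add_im a, ← Complex.re_add_im b]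
  linear_combination (Q * (b.im - a.im) / 2) * Complex.I_sq

theorem reVec_conj (v : CVec ι) :
    reVec (fun i => starRingEnd ℂ (v.2 i), fun i => starRingEnd ℂ (v.1 i)) = reVec v := by
  ext i; simp [reVec, add_comm]

theorem imVec_conj (v : CVec ι) :
    imVec (fun i => starRingEnd ℂ (v.2 i), fun i => starRingEnd ℂ (v.1 i)) = -imVec v := by
  ext i; simp [imVec]; ring

theorem act_congr {v : CVec ι} {f g : (ι → ℂ) → ℂ} {x : ι → ℂ} (h : f =ᶠ[𝓝 x] g) :
    act v f x = act v g x := by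
  rw [act_eq, act_eq, h.fderiv_eq]

theorem act_const (v : CVec ι) (c : ℂ) (x : ι → ℂ) : act v (fun _ => c) x = 0 := by
  simp [act_eq]

theorem act_add {v : CVec ι} {f g : (ι → ℂ) → ℂ} {x : ι → ℂ} (hf : DifferentiableAt ℝ f x)
    (hg : DifferentiableAt ℝ g x) : act v (fun y => f y + g y) x = act v f x + act v g x := by
  rw [act_eq, act_eq, act_eq, fderiv_fun_add hf hg]
  simp only [add_apply]
  ring

theorem act_mul {v : CVec ι} {f g : (ι → ℂ) → ℂ} {x : ι → ℂ} (hf : DifferentiableAt ℝ f x)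
    (hg : DifferentiableAt ℝ g x) :
    act v (fun y => f y * g y) x = f x * act v g x + g x * act v f x := by
  rw [act_eq, act_eq, act_eq, fderiv_fun_mul hf hg]
  simp only [add_apply, smul_apply, smul_eq_mul]
  ring

theorem act_const_mul {v : CVec ι} {f : (ι → ℂ) → ℂ} {x : ι → ℂ} (c : ℂ)
    (hf : DifferentiableAt ℝ f x) : act v (fun y => c * f y) x = c * act v f x := by
  rw [act_mul (differentiableAt_const c) hf, act_const, mul_zero, add_zero]

theorem act_neg {v : CVec ι} {f : (ι → ℂ) → ℂ} {x : ι → ℂ} :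
    act v (fun y => -f y) x = -act v f x := by
  rw [act_eq, act_eq, fderiv_fun_neg]
  simp only [neg_apply]
  ring

theorem act_sub {v : CVec ι} {f g : (ι → ℂ) → ℂ} {x : ι → ℂ} (hf : DifferentiableAt ℝ f x)
    (hg : DifferentiableAt ℝ g x) : act v (fun y => f y - g y) x = act v f x - act v g x := by
  simp only [sub_eq_add_neg]
  rw [act_add hf hg.fun_neg, act_neg]

theorem act_sum {α : Type*} (s : Finset α) {v : CVec ι} {f : α → (ι → ℂ) → ℂ} {x : ι → ℂ}
    (hf : ∀ a ∈ s, DifferentiableAt ℝ (f a) x) :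
    act v (fun y => ∑ a ∈ s, f a y) x = ∑ a ∈ s, act v (f a) x := by
  rw [act_eq, fderiv_fun_sum hf]
  simp only [act_eq, sum_apply, Finset.sum_add_distrib, Finset.mul_sum]

theorem act_conj (v : CVec ι) {f : (ι → ℂ) → ℂ} {x : ι → ℂ} (hf : DifferentiableAt ℝ f x) :
    act v (fun y => starRingEnd ℂ (f y)) x
      = starRingEnd ℂ (act (fun i => starRingEnd ℂ (v.2 i), fun i => starRingEnd ℂ (v.1 i)) f x) := by
  have h : fderiv ℝ (fun y => starRingEnd ℂ (f y)) x
      = Complex.conjCLE.toContinuousLinearMap.comp (fderiv ℝ f x) :=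
    (Complex.conjCLE.toContinuousLinearMap.hasFDerivAt.comp x hf.hasFDerivAt).fderiv
  rw [act_eq, act_eq, reVec_conj, imVec_conj, h]
  simp

/-- The chain rule: the differential of `φ` sends `u` to the complexified tangent vector whose
coefficients are the derivatives along `u` of the components of `φ` and of their conjugates. -/
theorem act_comp (u : CVec κ) {φ : (κ → ℂ) → ι → ℂ} {f : (ι → ℂ) → ℂ} {x : κ → ℂ}
    (hf : DifferentiableAt ℝ f (φ x)) (hφ : DifferentiableAt ℝ φ x) :
    act u (fun y => f (φ y)) x
      = act (fun i => act u (fun y => φ y i) x,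
          fun i => act u (fun y => starRingEnd ℂ (φ y i)) x) f (φ x) := by
  have h : fderiv ℝ (fun y => f (φ y)) x = (fderiv ℝ f (φ x)).comp (fderiv ℝ φ x) :=
    fderiv_comp x hf hφ
  have hc : ∀ i, DifferentiableAt ℝ (fun y => φ y i) x := differentiableAt_pi.1 hφ
  have hi : ∀ i ξ, fderiv ℝ (fun y => φ y i) x ξ = fderiv ℝ φ x ξ i := fun i ξ => by
    rw [fderiv_pi hc]; rfl
  have hr : reVec (fun i => act u (fun y => φ y i) x,
      fun i => act u (fun y => starRingEnd ℂ (φ y i)) x) = fderiv ℝ φ x (reVec u) := by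
    ext i
    simp only [reVec, act_conj u (hc i)]
    rw [act_eq, act_eq, reVec_conj, imVec_conj, hi, hi, hi]
    simp
    ring
  have him : imVec (fun i => act u (fun y => φ y i) x,
      fun i => act u (fun y => starRingEnd ℂ (φ y i)) x) = fderiv ℝ φ x (imVec u) := by
    ext i
    simp only [imVec, act_conj u (hc i)]
    rw [act_eq, act_eq, reVec_conj, imVec_conj, hi, hi, hi]
    simp
    ring_nf
    simp only [Complex.I_sq]
    ring
  rw [act_eq, act_eq (ι := ι), h, hr, him]
  rfl

theorem dz_eq_act (i : ι) (f : (ι → ℂ) → ℂ) (x : ι → ℂ) :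
    dz i f x = act (Pi.single i 1, 0) f x := by
  simp [act, Pi.single_apply]

theorem dzbar_eq_act (i : ι) (f : (ι → ℂ) → ℂ) (x : ι → ℂ) :
    dzbar i f x = act (0, Pi.single i 1) f x := by
  simp [act, Pi.single_apply]

theorem act_coord (v : CVec ι) (i : ι) (x : ι → ℂ) : act v (fun y => y i) x = v.1 i := by
  have h : fderiv ℝ (fun y : ι → ℂ => y i) x = ContinuousLinearMap.proj i :=
    (ContinuousLinearMap.proj (R := ℝ) (φ := fun _ : ι => ℂ) i).fderiv
  rw [act_eq, h]
  simp [reVec, imVec]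
  ring_nf
  simp only [Complex.I_sq]
  ring

theorem act_conj_coord (v : CVec ι) (i : ι) (x : ι → ℂ) :
    act v (fun y => starRingEnd ℂ (y i)) x = v.2 i := by
  rw [act_conj v (by fun_prop), act_coord]
  simp

theorem fderiv_act {f : (ι → ℂ) → ℂ} {x : ι → ℂ} (v : CVec ι) (hf : ContDiffAt ℝ 2 f x)
    (ζ : ι → ℂ) :
    fderiv ℝ (fun y => act v f y) x ζ = fderiv ℝ (fderiv ℝ f) x ζ (reVec v)
      + Complex.I * fderiv ℝ (fderiv ℝ f) x ζ (imVec v) := by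
  have h : HasFDerivAt (fderiv ℝ f) (fderiv ℝ (fderiv ℝ f) x) x :=
    ((hf.fderiv_right (m := 1) (by norm_num)).differentiableAt (by norm_num)).hasFDerivAt
  have h1 := h.clm_apply (hasFDerivAt_const (reVec v) x)
  have h2 := (h.clm_apply (hasFDerivAt_const (imVec v) x)).const_mul Complex.I
  have h3 := (h1.add h2).fderiv
  have h4 : (fun y => act v f y) = ((fun y => fderiv ℝ f y (reVec v))
      + fun y => Complex.I * fderiv ℝ f y (imVec v)) := by
    ext y; simp [act_eq]
  rw [h4, h3]
  simp

theorem act_act_const {f : (ι → ℂ) → ℂ} {x : ι → ℂ} (u v : CVec ι) (hf : ContDiffAt ℝ 2 f x) :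
    act u (fun y => act v f y) x = act v (fun y => act u f y) x := by
  have hs : IsSymmSndFDerivAt ℝ f x := hf.isSymmSndFDerivAt (by simp)
  rw [act_eq, act_eq (f := fun y => act u f y)]
  simp only [fderiv_act _ hf]
  rw [hs.eq (reVec u), hs.eq (reVec u), hs.eq (imVec u), hs.eq (imVec u)]
  ring

theorem contDiffOn_act_const {f : (ι → ℂ) → ℂ} {U : Set (ι → ℂ)} (hU : IsOpen U)
    (hf : ContDiffOn ℝ ∞ f U) (v : CVec ι) : ContDiffOn ℝ ∞ (fun y => act v f y) U := by
  have h : ContDiffOn ℝ ∞ (fderiv ℝ f) U := hf.fderiv_of_isOpen hU (by simp)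
  simp only [act_eq]
  exact (h.clm_apply contDiffOn_const).add (contDiffOn_const.mul (h.clm_apply contDiffOn_const))

theorem contDiffOn_dz {f : (ι → ℂ) → ℂ} {U : Set (ι → ℂ)} (hU : IsOpen U)
    (hf : ContDiffOn ℝ ∞ f U) (i : ι) : ContDiffOn ℝ ∞ (dz i f) U :=
  (contDiffOn_act_const hU hf _).congr fun y _ => dz_eq_act i f y

theorem contDiffOn_dzbar {f : (ι → ℂ) → ℂ} {U : Set (ι → ℂ)} (hU : IsOpen U)
    (hf : ContDiffOn ℝ ∞ f U) (i : ι) : ContDiffOn ℝ ∞ (dzbar i f) U :=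
  (contDiffOn_act_const hU hf _).congr fun y _ => dzbar_eq_act i f y

theorem contDiffOn_fst {X : (ι → ℂ) → CVec ι} {U : Set (ι → ℂ)} (hX : ContDiffOn ℝ ∞ X U)
    (i : ι) : ContDiffOn ℝ ∞ (fun y => (X y).1 i) U :=
  contDiffOn_pi.1 hX.fst i

theorem contDiffOn_snd {X : (ι → ℂ) → CVec ι} {U : Set (ι → ℂ)} (hX : ContDiffOn ℝ ∞ X U)
    (i : ι) : ContDiffOn ℝ ∞ (fun y => (X y).2 i) U :=
  contDiffOn_pi.1 hX.snd i

theorem contDiffOn_act {f : (ι → ℂ) → ℂ} {X : (ι → ℂ) → CVec ι} {U : Set (ι → ℂ)} (hU : IsOpen U)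
    (hX : ContDiffOn ℝ ∞ X U) (hf : ContDiffOn ℝ ∞ f U) :
    ContDiffOn ℝ ∞ (fun y => act (X y) f y) U := by
  simp only [act]
  exact (ContDiffOn.sum fun i _ => (contDiffOn_fst hX i).mul (contDiffOn_dz hU hf i)).add
    (ContDiffOn.sum fun i _ => (contDiffOn_snd hX i).mul (contDiffOn_dzbar hU hf i))

theorem contDiffOn_bracket {X Y : (ι → ℂ) → CVec ι} {U : Set (ι → ℂ)} (hU : IsOpen U)
    (hX : ContDiffOn ℝ ∞ X U) (hY : ContDiffOn ℝ ∞ Y U) :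
    ContDiffOn ℝ ∞ (bracket X Y) U :=
  (contDiffOn_pi.2 fun i => (contDiffOn_act hU hX (contDiffOn_fst hY i)).sub
      (contDiffOn_act hU hY (contDiffOn_fst hX i))).prodMk
    (contDiffOn_pi.2 fun i => (contDiffOn_act hU hX (contDiffOn_snd hY i)).sub
      (contDiffOn_act hU hY (contDiffOn_snd hX i)))

theorem contDiffOn_conjField {X : (ι → ℂ) → CVec ι} {U : Set (ι → ℂ)}
    (hX : ContDiffOn ℝ ∞ X U) : ContDiffOn ℝ ∞ (conjField X) U :=
  (contDiffOn_pi.2 fun i =>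
      Complex.conjCLE.contDiff.comp_contDiffOn (contDiffOn_snd hX i)).prodMk
    (contDiffOn_pi.2 fun i => Complex.conjCLE.contDiff.comp_contDiffOn (contDiffOn_fst hX i))

theorem differentiableAt_of_contDiffOn {E F : Type*} [NormedAddCommGroup E] [NormedSpace ℝ E]
    [NormedAddCommGroup F] [NormedSpace ℝ F] {f : E → F} {U : Set E} (hU : IsOpen U)
    (hf : ContDiffOn ℝ ∞ f U) {x : E} (hx : x ∈ U) : DifferentiableAt ℝ f x :=
  (hf.contDiffAt (hU.mem_nhds hx)).differentiableAt (by simp)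

/-- Differentiating `Y f` along a vector `u`: the first term differentiates the coefficients of
`Y`, the second one freezes them. -/
theorem act_act {f : (ι → ℂ) → ℂ} {Y : (ι → ℂ) → CVec ι} {U : Set (ι → ℂ)} (hU : IsOpen U)
    (hY : ContDiffOn ℝ ∞ Y U) (hf : ContDiffOn ℝ ∞ f U) {x : ι → ℂ} (hx : x ∈ U) (u : CVec ι) :
    act u (fun y => act (Y y) f y) x
      = act (fun i => act u (fun y => (Y y).1 i) x, fun i => act u (fun y => (Y y).2 i) x) f x
        + act u (fun y => act (Y x) f y) x := by
  have d1 := fun i => differentiableAt_of_contDiffOn hU (contDiffOn_fst hY i) hx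
  have d2 := fun i => differentiableAt_of_contDiffOn hU (contDiffOn_snd hY i) hx
  have d3 := fun i => differentiableAt_of_contDiffOn hU (contDiffOn_dz hU hf i) hx
  have d4 := fun i => differentiableAt_of_contDiffOn hU (contDiffOn_dzbar hU hf i) hx
  have key : ∀ Z : (ι → ℂ) → CVec ι, (∀ i, DifferentiableAt ℝ (fun y => (Z y).1 i) x) →
      (∀ i, DifferentiableAt ℝ (fun y => (Z y).2 i) x) →
      act u (fun y => act (Z y) f y) x
        = (∑ i, ((Z x).1 i * act u (dz i f) x + dz i f x * act u (fun y => (Z y).1 i) x))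
        + ∑ i, ((Z x).2 i * act u (dzbar i f) x + dzbar i f x * act u (fun y => (Z y).2 i) x) := by
    intro Z e1 e2
    change act u (fun y => (∑ i, (Z y).1 i * dz i f y) + ∑ i, (Z y).2 i * dzbar i f y) x = _
    rw [act_add (DifferentiableAt.fun_sum fun i _ => (e1 i).fun_mul (d3 i))
        (DifferentiableAt.fun_sum fun i _ => (e2 i).fun_mul (d4 i)),
      act_sum _ (fun i _ => (e1 i).fun_mul (d3 i)), act_sum _ (fun i _ => (e2 i).fun_mul (d4 i))]
    congr 1
    · exact Finset.sum_congr rfl fun i _ => act_mul (e1 i) (d3 i)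
    · exact Finset.sum_congr rfl fun i _ => act_mul (e2 i) (d4 i)
  rw [key Y d1 d2, key (fun _ => Y x) (fun i => differentiableAt_const _)
    (fun i => differentiableAt_const _), act]
  simp only [act_const, Finset.sum_add_distrib, mul_zero, Finset.sum_const_zero]
  simp only [mul_comm]
  ring

/-- The Lie bracket acts on functions as the commutator. -/
theorem act_bracket {f : (ι → ℂ) → ℂ} {X Y : (ι → ℂ) → CVec ι} {U : Set (ι → ℂ)} (hU : IsOpen U)
    (hX : ContDiffOn ℝ ∞ X U) (hY : ContDiffOn ℝ ∞ Y U) (hf : ContDiffOn ℝ ∞ f U) {x : ι → ℂ}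
    (hx : x ∈ U) :
    act (bracket X Y x) f x
      = act (X x) (fun y => act (Y y) f y) x - act (Y x) (fun y => act (X y) f y) x := by
  have hf2 : ContDiffAt ℝ 2 f x :=
    (hf.contDiffAt (hU.mem_nhds hx)).of_le (WithTop.coe_le_coe.2 le_top)
  rw [act_act hU hY hf hx, act_act hU hX hf hx, act_act_const (X x) (Y x) hf2]
  simp only [act, bracket, sub_mul, Finset.sum_sub_distrib]
  ring

end Calculus

/-! ### Complexified tangent spaces -/

section Tangent

variable {ι : Type*} [Fintype ι] [DecidableEq ι]

theorem act_eq_zero_of_mem {S U : Set (ι → ℂ)} {q : ι → ℂ} {v : CVec ι}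
    (hv : v ∈ complexTangent S q) (hU : IsOpen U) (hq : q ∈ U) {g : (ι → ℂ) → ℂ}
    (hg : ContDiffOn ℝ ∞ g U) (h0 : ∀ x ∈ S ∩ U, g x = 0) : act v g q = 0 := by
  have hr : ContDiffOn ℝ ∞ (fun y => (g y).re) U := Complex.reCLM.contDiff.comp_contDiffOn hg
  have hi : ContDiffOn ℝ ∞ (fun y => (g y).im) U := Complex.imCLM.contDiff.comp_contDiffOn hg
  have h1 := hv U _ hU hq hr fun x hx => by simp [h0 x hx]
  have h2 := hv U _ hU hq hi fun x hx => by simp [h0 x hx]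
  have dr : DifferentiableAt ℝ (fun y => ((g y).re : ℂ)) q :=
    Complex.ofRealCLM.differentiableAt.comp q (differentiableAt_of_contDiffOn hU hr hq)
  have di : DifferentiableAt ℝ (fun y => ((g y).im : ℂ)) q :=
    Complex.ofRealCLM.differentiableAt.comp q (differentiableAt_of_contDiffOn hU hi hq)
  have h3 : g = fun y => ((g y).re : ℂ) + Complex.I * ((g y).im : ℂ) := by
    ext y; rw [mul_comm, Complex.re_add_im]
  rw [h3, act_add dr (di.const_mul _), act_const_mul _ di, h1, h2]
  simp

theorem complexTangent_mono {S M : Set (ι → ℂ)} (h : S ⊆ M) (q : ι → ℂ) :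
    complexTangent S q ≤ complexTangent M q := fun _ hv U f hU hq hf h0 =>
  hv U f hU hq hf fun x hx => h0 x ⟨h hx.1, hx.2⟩

theorem conj_mem_complexTangent {S : Set (ι → ℂ)} {q : ι → ℂ} {v : CVec ι}
    (hv : v ∈ complexTangent S q) :
    ((fun i => starRingEnd ℂ (v.2 i), fun i => starRingEnd ℂ (v.1 i)) : CVec ι)
      ∈ complexTangent S q := by
  intro U f hU hq hf h0
  have h1 := hv U f hU hq hf h0
  have d : DifferentiableAt ℝ (fun y => (f y : ℂ)) q :=
    Complex.ofRealCLM.differentiableAt.comp q (differentiableAt_of_contDiffOn hU hf hq)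
  have h2 := act_conj v d
  simp only [Complex.conj_ofReal] at h2
  rw [h1] at h2
  exact (map_eq_zero _).1 h2.symm

/-- If `X` and `Y` are tangent to `S`, so is `[X, Y]`: a function vanishing on `S` is sent by `X`
and by `Y` to functions vanishing on `S`. -/
theorem bracket_mem_complexTangent {S V : Set (ι → ℂ)} {X Y : (ι → ℂ) → CVec ι} (hV : IsOpen V)
    (hX : ContDiffOn ℝ ∞ X V) (hY : ContDiffOn ℝ ∞ Y V)
    (hXS : ∀ x ∈ S ∩ V, X x ∈ complexTangent S x) (hYS : ∀ x ∈ S ∩ V, Y x ∈ complexTangent S x)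
    {x : ι → ℂ} (hx : x ∈ S ∩ V) : bracket X Y x ∈ complexTangent S x := by
  intro U f hU hq hf h0
  have hUV := hU.inter hV
  have hf' : ContDiffOn ℝ ∞ (fun y => (f y : ℂ)) (U ∩ V) :=
    Complex.ofRealCLM.contDiff.comp_contDiffOn (hf.mono Set.inter_subset_left)
  have hX' := hX.mono (Set.inter_subset_right (s := U))
  have hY' := hY.mono (Set.inter_subset_right (s := U))
  have hx' : x ∈ U ∩ V := ⟨hq, hx.2⟩
  rw [act_bracket hUV hX' hY' hf' hx',
    act_eq_zero_of_mem (hXS x hx) hUV hx' (contDiffOn_act hUV hY' hf')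
      (fun y hy => hYS y ⟨hy.1, hy.2.2⟩ U f hU hy.2.1 hf h0),
    act_eq_zero_of_mem (hYS x hx) hUV hx' (contDiffOn_act hUV hX' hf')
      (fun y hy => hXS y ⟨hy.1, hy.2.2⟩ U f hU hy.2.1 hf h0), sub_zero]

/-- The derivative of `f` at `x` as a linear form on complexified tangent vectors. -/
noncomputable def actLin (f : (ι → ℂ) → ℂ) (x : ι → ℂ) : CVec ι →ₗ[ℂ] ℂ where
  toFun v := act v f x
  map_add' v w := by
    simp only [act, Prod.fst_add, Prod.snd_add, Pi.add_apply, add_mul, Finset.sum_add_distrib]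
    ring
  map_smul' c v := by
    simp only [act, Prod.smul_fst, Prod.smul_snd, Pi.smul_apply, smul_eq_mul, mul_add,
      Finset.mul_sum, mul_assoc, RingHom.id_apply]

theorem finrank_complexTangent_le {S : Set (ι → ℂ)} {k : ℕ} (hS : IsSmoothSubmanifold S k)
    {q : ι → ℂ} (hq : q ∈ S) : Module.finrank ℂ (complexTangent S q) ≤ k := by
  obtain ⟨c, U, ρ, hkc, hU, hqU, hρ, hSU, hsurj⟩ := hS q hq
  have hρi : ∀ i, ContDiffOn ℝ ∞ (fun y => ρ y i) U := contDiffOn_pi.1 hρ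
  let Φ : CVec ι →ₗ[ℂ] (Fin c → ℂ) := LinearMap.pi fun i => actLin (fun y => (ρ y i : ℂ)) q
  have hle : complexTangent S q ≤ LinearMap.ker Φ := by
    intro v hv
    rw [LinearMap.mem_ker]
    ext i
    refine hv U _ hU hqU (hρi i) fun x hx => ?_
    rw [hSU] at hx
    simp [hx.2]
  have hreal : ∀ ξ i, fderiv ℝ (fun y => (ρ y i : ℂ)) q ξ = (fderiv ℝ ρ q ξ i : ℂ) := by
    intro ξ i
    have h1 : HasFDerivAt (fun y => ρ y i) _ q :=
      (hasFDerivAt_pi'.1 (differentiableAt_of_contDiffOn hU hρ hqU).hasFDerivAt) i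
    have h2 := (Complex.ofRealCLM.hasFDerivAt.comp q h1).fderiv
    change fderiv ℝ (Complex.ofRealCLM ∘ fun y => ρ y i) q ξ = _
    rw [h2]
    rfl
  have hΦ : LinearMap.range Φ = ⊤ := by
    rw [LinearMap.range_eq_top]
    intro t
    obtain ⟨ξ, hξ⟩ := hsurj q ⟨hq, hqU⟩ fun i => (t i).re
    obtain ⟨η, hη⟩ := hsurj q ⟨hq, hqU⟩ fun i => (t i).im
    refine ⟨(fun i => ξ i + Complex.I * η i,
      fun i => starRingEnd ℂ (ξ i) + Complex.I * starRingEnd ℂ (η i)), ?_⟩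
    ext i
    change act _ _ q = _
    have h1 : reVec (fun i => ξ i + Complex.I * η i,
      fun i => starRingEnd ℂ (ξ i) + Complex.I * starRingEnd ℂ (η i)) = ξ := by
      ext i; simp [reVec]; ring
    have h2 : imVec (fun i => ξ i + Complex.I * η i,
      fun i => starRingEnd ℂ (ξ i) + Complex.I * starRingEnd ℂ (η i)) = η := by
      ext i; simp [imVec]; ring_nf; simp [Complex.I_sq]
    rw [act_eq, h1, h2, hreal, hreal, hξ, hη, mul_comm, Complex.re_add_im]
  have h1 := LinearMap.finrank_range_add_finrank_ker Φ
  have h2 := Submodule.finrank_mono hle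
  rw [hΦ, finrank_top] at h1
  simp only [Module.finrank_prod, Module.finrank_fintype_fun_eq_card, Fintype.card_fin] at h1
  omega

end Tangent

/-! ### Tangent vectors of a graph -/

section Graph

variable {n : ℕ}

/-- The image of a complexified tangent vector of `ℂ^{n+1}` under the projection `(z, w) ↦ z`. -/
def zvec (v : CVec (Fin (n + 1))) : CVec (Fin n) :=
  (fun i => v.1 i.castSucc, fun i => v.2 i.castSucc)

theorem contDiff_zpart : ContDiff ℝ ∞ (zpart (n := n)) :=
  contDiff_pi.2 fun i => contDiff_apply ℝ ℂ (Fin.castSucc i)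

theorem act_comp_zpart (v : CVec (Fin (n + 1))) {f : (Fin n → ℂ) → ℂ} {x : Fin (n + 1) → ℂ}
    (hf : DifferentiableAt ℝ f (zpart x)) :
    act v (fun y => f (zpart y)) x = act (zvec v) f (zpart x) := by
  rw [act_comp v hf (contDiff_zpart.differentiable (by simp) x)]
  have h1 : ∀ i : Fin n, act v (fun y => zpart y i) x = v.1 i.castSucc := fun i =>
    act_coord v i.castSucc x
  have h2 : ∀ i : Fin n, act v (fun y => starRingEnd ℂ (zpart y i)) x = v.2 i.castSucc := fun i =>
    act_conj_coord v i.castSucc x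
  simp only [h1, h2, zvec]

/-- The function `G + √-1 E` whose graph is considered. -/
noncomputable def gph (G E : (Fin n → ℂ) → ℝ) (z : Fin n → ℂ) : ℂ := G z + Complex.I * E z

/-- The parametrization `z ↦ (z, G(z) + √-1 E(z))`. -/
noncomputable def graphMap (G E : (Fin n → ℂ) → ℝ) (z : Fin n → ℂ) : Fin (n + 1) → ℂ :=
  Fin.snoc (α := fun _ => ℂ) z (gph G E z)

variable {Ω : Set (Fin n → ℂ)} {G E : (Fin n → ℂ) → ℝ}

theorem zpart_graphMap (z : Fin n → ℂ) : zpart (graphMap G E z) = z := by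
  ext i; simp [zpart, graphMap]

theorem graphMap_zpart {x : Fin (n + 1) → ℂ} (hx : x ∈ graphSet Ω G E) :
    graphMap G E (zpart x) = x := by
  ext i
  refine Fin.lastCases ?_ (fun i => ?_) i
  · simp [graphMap, gph, hx.2]
  · simp [graphMap, zpart]

theorem graphMap_mem {z : Fin n → ℂ} (hz : z ∈ Ω) : graphMap G E z ∈ graphSet Ω G E := by
  refine ⟨by rwa [zpart_graphMap], ?_⟩
  rw [zpart_graphMap]
  simp [graphMap, gph]

theorem contDiffOn_ofReal (hG : ContDiffOn ℝ ∞ G Ω) : ContDiffOn ℝ ∞ (fun z => (G z : ℂ)) Ω :=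
  Complex.ofRealCLM.contDiff.comp_contDiffOn hG

theorem contDiffOn_conj {f : (Fin n → ℂ) → ℂ} (hf : ContDiffOn ℝ ∞ f Ω) :
    ContDiffOn ℝ ∞ (fun z => starRingEnd ℂ (f z)) Ω :=
  Complex.conjCLE.contDiff.comp_contDiffOn hf

theorem contDiffOn_gph (hG : ContDiffOn ℝ ∞ G Ω) (hE : ContDiffOn ℝ ∞ E Ω) :
    ContDiffOn ℝ ∞ (gph G E) Ω :=
  (contDiffOn_ofReal hG).add (contDiffOn_const.mul (contDiffOn_ofReal hE))

theorem contDiffOn_graphMap (hG : ContDiffOn ℝ ∞ G Ω) (hE : ContDiffOn ℝ ∞ E Ω) :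
    ContDiffOn ℝ ∞ (graphMap G E) Ω := by
  refine contDiffOn_pi.2 fun i => Fin.lastCases ?_ (fun i => ?_) i
  · simpa [graphMap] using contDiffOn_gph hG hE
  · simpa [graphMap] using (contDiff_apply ℝ ℂ i).contDiffOn

theorem mem_complexTangent_graph_iff (hΩ : IsOpen Ω) (hG : ContDiffOn ℝ ∞ G Ω)
    (hE : ContDiffOn ℝ ∞ E Ω) {x : Fin (n + 1) → ℂ} (hx : x ∈ graphSet Ω G E)
    (v : CVec (Fin (n + 1))) :
    v ∈ complexTangent (graphSet Ω G E) x ↔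
      v.1 (Fin.last n) = act (zvec v) (gph G E) (zpart x) ∧
      v.2 (Fin.last n) = act (zvec v) (fun z => starRingEnd ℂ (gph G E z)) (zpart x) := by
  have hg := contDiffOn_gph hG hE
  have hg' := contDiffOn_conj hg
  have dg := differentiableAt_of_contDiffOn hΩ hg hx.1
  have dg' := differentiableAt_of_contDiffOn hΩ hg' hx.1
  have hV : IsOpen (zpart ⁻¹' Ω : Set (Fin (n + 1) → ℂ)) :=
    hΩ.preimage contDiff_zpart.continuous
  have dz := contDiff_zpart (n := n) |>.differentiable (by simp) x
  have hmap : Set.MapsTo (zpart (n := n)) (zpart ⁻¹' Ω) Ω := fun _ h => h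
  constructor
  · intro hv
    constructor
    · have h := act_eq_zero_of_mem hv hV hx.1
        (g := fun y => y (Fin.last n) - gph G E (zpart y))
        ((contDiff_apply ℝ ℂ (Fin.last n)).contDiffOn.sub (hg.comp contDiff_zpart.contDiffOn hmap))
        (fun y hy => by simp [gph, hy.1.2])
      rw [act_sub (by fun_prop) (dg.fun_comp' x dz), act_coord, act_comp_zpart v dg] at h
      exact sub_eq_zero.1 h
    · have h := act_eq_zero_of_mem hv hV hx.1
        (g := fun y => starRingEnd ℂ (y (Fin.last n)) - starRingEnd ℂ (gph G E (zpart y)))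
        ((Complex.conjCLE.contDiff.comp (contDiff_apply ℝ ℂ (Fin.last n))).contDiffOn.sub
          (hg'.comp contDiff_zpart.contDiffOn hmap))
        (fun y hy => by simp [gph, hy.1.2])
      rw [act_sub (by fun_prop) (dg'.fun_comp' x dz), act_conj_coord, act_comp_zpart v dg'] at h
      exact sub_eq_zero.1 h
  · rintro ⟨h1, h2⟩ U f hU hxU hf h0
    have hφ := graphMap_zpart hx
    have dφ : DifferentiableAt ℝ (graphMap G E) (zpart x) :=
      differentiableAt_of_contDiffOn hΩ (contDiffOn_graphMap hG hE) hx.1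
    have df : DifferentiableAt ℝ (fun y => (f y : ℂ)) (graphMap G E (zpart x)) := by
      rw [hφ]
      exact Complex.ofRealCLM.differentiableAt.comp x (differentiableAt_of_contDiffOn hU hf hxU)
    have h3 := act_comp (zvec v) df dφ
    -- `v` is the image of `zvec v` under the differential of the parametrization
    have h4 : ((fun i => act (zvec v) (fun y => graphMap G E y i) (zpart x),
        fun i => act (zvec v) (fun y => starRingEnd ℂ (graphMap G E y i)) (zpart x)) :
          CVec (Fin (n + 1))) = v := by
      ext i
      · refine Fin.lastCases ?_ (fun i => ?_) i
        · simp only [graphMap, Fin.snoc_last]; exact h1.symm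
        · simp only [graphMap, Fin.snoc_castSucc, act_coord]; rfl
      · refine Fin.lastCases ?_ (fun i => ?_) i
        · simp only [graphMap, Fin.snoc_last]; exact h2.symm
        · simp only [graphMap, Fin.snoc_castSucc, act_conj_coord]; rfl
    rw [h4, hφ] at h3
    rw [← h3]
    have h5 : (fun y => (f (graphMap G E y) : ℂ)) =ᶠ[𝓝 (zpart x)] fun _ => 0 := by
      have hU' : graphMap G E ⁻¹' U ∈ 𝓝 (zpart x) :=
        dφ.continuousAt.preimage_mem_nhds (hU.mem_nhds (by rwa [hφ]))
      filter_upwards [hU', hΩ.mem_nhds hx.1] with z hz hzΩ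
      simp [h0 _ ⟨graphMap_mem hzΩ, hz⟩]
    rw [act_congr h5, act_const]

end Graph

/-! ### The fields `L_j` span the `(1,0)`-tangent space -/

section Fields

variable {N : ℕ} {G E : (Fin (N + 1) → ℂ) → ℝ} {Ω : Set (Fin (N + 1) → ℂ)}

theorem dz_conj_gph (hΩ : IsOpen Ω) (hG : ContDiffOn ℝ ∞ G Ω) (hE : ContDiffOn ℝ ∞ E Ω)
    {z : Fin (N + 1) → ℂ} (hz : z ∈ Ω) (i : Fin (N + 1)) :
    dz i (fun y => starRingEnd ℂ (gph G E y)) z = rdz i G z - Complex.I * rdz i E z := by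
  have dG := differentiableAt_of_contDiffOn hΩ (contDiffOn_ofReal hG) hz
  have dE := differentiableAt_of_contDiffOn hΩ (contDiffOn_ofReal hE) hz
  have h : (fun y => starRingEnd ℂ (gph G E y)) = fun y => (G y : ℂ) - Complex.I * E y := by
    ext y; simp [gph, sub_eq_add_neg]
  rw [h, dz_eq_act, act_sub dG (dE.const_mul _), act_const_mul _ dE, rdz, rdz, dz_eq_act,
    dz_eq_act]

theorem dz_gph (hΩ : IsOpen Ω) (hG : ContDiffOn ℝ ∞ G Ω) (hE : ContDiffOn ℝ ∞ E Ω)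
    {z : Fin (N + 1) → ℂ} (hz : z ∈ Ω) (i : Fin (N + 1)) :
    dz i (gph G E) z = rdz i G z + Complex.I * rdz i E z := by
  have dG := differentiableAt_of_contDiffOn hΩ (contDiffOn_ofReal hG) hz
  have dE := differentiableAt_of_contDiffOn hΩ (contDiffOn_ofReal hE) hz
  have h : gph G E = fun y => (G y : ℂ) + Complex.I * E y := rfl
  rw [h, dz_eq_act, act_add dG (dE.const_mul _), act_const_mul _ dE, rdz, rdz, dz_eq_act,
    dz_eq_act]

variable (G E) in
theorem L_castSucc (j h : Fin N) (x : Fin (N + 1 + 1) → ℂ) :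
    (L G E j x).1 h.castSucc.castSucc = if h = j then cA G E (zpart x) else 0 := by
  simp [L, Pi.single_apply, Fin.castSucc_ne_last, Fin.castSucc_inj]

variable (G E) in
theorem L_n (j : Fin N) (x : Fin (N + 1 + 1) → ℂ) :
    (L G E j x).1 (Fin.last N).castSucc = -cB G E j (zpart x) := by
  have : (Fin.last N) ≠ j.castSucc := (Fin.castSucc_ne_last j).symm
  simp [L, Fin.castSucc_ne_last, Fin.castSucc_inj, this]

variable (G E) in
theorem L_last (j : Fin N) (x : Fin (N + 1 + 1) → ℂ) :
    (L G E j x).1 (Fin.last (N + 1)) = cC G E j (zpart x) := by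
  have : ∀ i : Fin (N + 1), Fin.last (N + 1) ≠ i.castSucc := fun i => (Fin.castSucc_ne_last i).symm
  simp [L, this]

theorem L_mem_holTangent (hΩ : IsOpen Ω) (hG : ContDiffOn ℝ ∞ G Ω) (hE : ContDiffOn ℝ ∞ E Ω)
    {x : Fin (N + 1 + 1) → ℂ} (hx : x ∈ graphSet Ω G E) (j : Fin N) :
    L G E j x ∈ holTangent (graphSet Ω G E) x := by
  refine ⟨(mem_complexTangent_graph_iff hΩ hG hE hx _).2 ?_, by simp [L]⟩
  simp only [act, zvec, Fin.sum_univ_castSucc, dz_conj_gph hΩ hG hE hx.1, dz_gph hΩ hG hE hx.1,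
    L_castSucc, L_n, L_last]
  simp only [cA, cB, cC, L]
  constructor
  · simp
    ring_nf
  · simp
    ring_nf

/-- If `A ≠ 0`, the equations of the `(1,0)`-tangent space express the coefficients of `∂/∂z_n` and
`∂/∂w` through the other ones. -/
theorem holTangent_eq_span (hΩ : IsOpen Ω) (hG : ContDiffOn ℝ ∞ G Ω) (hE : ContDiffOn ℝ ∞ E Ω)
    {x : Fin (N + 1 + 1) → ℂ} (hx : x ∈ graphSet Ω G E) (hA : cA G E (zpart x) ≠ 0) :
    holTangent (graphSet Ω G E) x = Submodule.span ℂ (Set.range fun j => L G E j x) := by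
  apply le_antisymm
  · rintro v ⟨hv, hv0⟩
    have hv2 : v.2 = 0 := by simpa using hv0
    obtain ⟨h1, h2⟩ := (mem_complexTangent_graph_iff hΩ hG hE hx v).1 hv
    simp only [act, zvec, hv2, Fin.sum_univ_castSucc, dz_conj_gph hΩ hG hE hx.1,
      dz_gph hΩ hG hE hx.1] at h1 h2
    simp only [Pi.zero_apply, zero_mul, Finset.sum_const_zero, add_zero] at h1 h2
    have hv' : v = ∑ j, (v.1 j.castSucc.castSucc / cA G E (zpart x)) • L G E j x := by
      have hs : ∀ i, (∑ j, (v.1 j.castSucc.castSucc / cA G E (zpart x)) • L G E j x).1 i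
          = ∑ j, (v.1 j.castSucc.castSucc / cA G E (zpart x)) * (L G E j x).1 i := by
        intro i
        simp [Prod.fst_sum, Finset.sum_apply]
      apply Prod.ext
      · ext i
        rw [hs]
        refine Fin.lastCases ?_ (fun i => Fin.lastCases ?_ (fun i => ?_) i) i
        · simp only [L_last]
          have : ∀ j, v.1 j.castSucc.castSucc / cA G E (zpart x) * cC G E j (zpart x)
              = v.1 j.castSucc.castSucc * (rdz j.castSucc G (zpart x)
                  + Complex.I * rdz j.castSucc E (zpart x))
                - v.1 j.castSucc.castSucc * (rdz j.castSucc G (zpart x)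
                  - Complex.I * rdz j.castSucc E (zpart x)) *
                  ((rdz (Fin.last N) G (zpart x) + Complex.I * rdz (Fin.last N) E (zpart x))
                    / cA G E (zpart x)) := by
            intro j
            field_simp
            simp only [cA, cC]
            ring
          rw [h1, Finset.sum_congr rfl fun j _ => this j, Finset.sum_sub_distrib, ← Finset.sum_mul]
          have h3 : ∑ j : Fin N, v.1 j.castSucc.castSucc * (rdz j.castSucc G (zpart x)
                  - Complex.I * rdz j.castSucc E (zpart x))
              = -(v.1 (Fin.last N).castSucc * cA G E (zpart x)) := by
            rw [cA]; linear_combination -h2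
          rw [h3]
          field_simp
          ring
        · simp only [L_n]
          have : ∀ j, v.1 j.castSucc.castSucc / cA G E (zpart x) * -cB G E j (zpart x)
              = v.1 j.castSucc.castSucc * (rdz j.castSucc G (zpart x)
                  - Complex.I * rdz j.castSucc E (zpart x)) * (-(cA G E (zpart x))⁻¹) := by
            intro j
            rw [cB]; ring
          rw [Finset.sum_congr rfl fun j _ => this j, ← Finset.sum_mul]
          have h3 : ∑ j : Fin N, v.1 j.castSucc.castSucc * (rdz j.castSucc G (zpart x)
                  - Complex.I * rdz j.castSucc E (zpart x))
              = -(v.1 (Fin.last N).castSucc * cA G E (zpart x)) := by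
            rw [cA]; linear_combination -h2
          rw [h3]
          field_simp
        · simp only [L_castSucc, mul_ite, mul_zero, Finset.sum_ite_eq, Finset.mem_univ, if_true]
          field_simp
      · rw [hv2]
        simp [Prod.snd_sum, L]
    rw [hv']
    exact Submodule.sum_mem _ fun j _ =>
      Submodule.smul_mem _ _ (Submodule.subset_span ⟨j, rfl⟩)
  · rw [Submodule.span_le]
    rintro _ ⟨j, rfl⟩
    exact L_mem_holTangent hΩ hG hE hx j

theorem Lbar_fst (j : Fin N) (x : Fin (N + 1 + 1) → ℂ) : (Lbar G E j x).1 = 0 := by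
  ext i; simp [Lbar, conjField, L]

theorem Lbar_snd (j : Fin N) (x : Fin (N + 1 + 1) → ℂ) (i : Fin (N + 1 + 1)) :
    (Lbar G E j x).2 i = starRingEnd ℂ ((L G E j x).1 i) := rfl

theorem linearIndependent_L_Lbar {x : Fin (N + 1 + 1) → ℂ} (hA : cA G E (zpart x) ≠ 0) :
    LinearIndependent ℂ (Sum.elim (fun j => L G E j x) (fun j => Lbar G E j x)) := by
  rw [Fintype.linearIndependent_iff]
  intro c hc
  rw [Fintype.sum_sum_type] at hc
  simp only [Sum.elim_inl, Sum.elim_inr] at hc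
  rintro (h | h)
  · have h1 := congrArg (fun v : CVec (Fin (N + 1 + 1)) => v.1 h.castSucc.castSucc) hc
    simp [Prod.fst_sum, Finset.sum_apply, Lbar_fst, L_castSucc, hA] at h1
    exact h1
  · have h1 := congrArg (fun v : CVec (Fin (N + 1 + 1)) => v.2 h.castSucc.castSucc) hc
    have h2 : ∀ j, (L G E j x).2 = 0 := fun _ => rfl
    simp [Prod.snd_sum, Finset.sum_apply, Lbar_snd, L_castSucc, hA, h2,
      apply_ite (starRingEnd ℂ)] at h1
    exact h1

theorem crDim_graph (hΩ : IsOpen Ω) (hG : ContDiffOn ℝ ∞ G Ω) (hE : ContDiffOn ℝ ∞ E Ω)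
    {x : Fin (N + 1 + 1) → ℂ} (hx : x ∈ graphSet Ω G E) (hA : cA G E (zpart x) ≠ 0) :
    crDim (graphSet Ω G E) x = N := by
  rw [crDim, holTangent_eq_span hΩ hG hE hx hA]
  have h := (linearIndependent_L_Lbar hA).comp Sum.inl Sum.inl_injective
  exact (finrank_span_eq_card h).trans (Fintype.card_fin N)

theorem contDiffOn_rdz (hΩ : IsOpen Ω) (hG : ContDiffOn ℝ ∞ G Ω) (i : Fin (N + 1)) :
    ContDiffOn ℝ ∞ (rdz i G) Ω :=
  contDiffOn_dz hΩ (contDiffOn_ofReal hG) i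

theorem contDiffOn_cA (hΩ : IsOpen Ω) (hG : ContDiffOn ℝ ∞ G Ω) (hE : ContDiffOn ℝ ∞ E Ω) :
    ContDiffOn ℝ ∞ (cA G E) Ω :=
  (contDiffOn_rdz hΩ hG _).sub (contDiffOn_const.mul (contDiffOn_rdz hΩ hE _))

theorem contDiffOn_cB (hΩ : IsOpen Ω) (hG : ContDiffOn ℝ ∞ G Ω) (hE : ContDiffOn ℝ ∞ E Ω)
    (j : Fin N) : ContDiffOn ℝ ∞ (cB G E j) Ω :=
  (contDiffOn_rdz hΩ hG _).sub (contDiffOn_const.mul (contDiffOn_rdz hΩ hE _))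

theorem contDiffOn_cC (hΩ : IsOpen Ω) (hG : ContDiffOn ℝ ∞ G Ω) (hE : ContDiffOn ℝ ∞ E Ω)
    (j : Fin N) : ContDiffOn ℝ ∞ (cC G E j) Ω :=
  contDiffOn_const.mul (((contDiffOn_rdz hΩ hG _).mul (contDiffOn_rdz hΩ hE _)).sub
    ((contDiffOn_rdz hΩ hG _).mul (contDiffOn_rdz hΩ hE _)))

theorem contDiffOn_comp_zpart {f : (Fin (N + 1) → ℂ) → ℂ} (hf : ContDiffOn ℝ ∞ f Ω) :
    ContDiffOn ℝ ∞ (fun x => f (zpart x)) (zpart ⁻¹' Ω) :=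
  hf.comp contDiff_zpart.contDiffOn fun _ h => h

theorem contDiffOn_L (hΩ : IsOpen Ω) (hG : ContDiffOn ℝ ∞ G Ω) (hE : ContDiffOn ℝ ∞ E Ω)
    (j : Fin N) : ContDiffOn ℝ ∞ (L G E j) (zpart ⁻¹' Ω) := by
  refine ContDiffOn.prodMk (contDiffOn_pi.2 fun i => ?_) contDiffOn_const
  have hs : ∀ (k : Fin (N + 1 + 1)) {f : (Fin (N + 1) → ℂ) → ℂ}, ContDiffOn ℝ ∞ f Ω →
      ContDiffOn ℝ ∞ (fun x => (Pi.single k (f (zpart x)) : Fin (N + 1 + 1) → ℂ) i)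
        (zpart ⁻¹' Ω) := by
    intro k f hf
    by_cases h : i = k
    · subst h; simpa using contDiffOn_comp_zpart hf
    · simpa [Pi.single_apply, h] using contDiffOn_const
  exact ((hs _ (contDiffOn_cA hΩ hG hE)).sub (hs _ (contDiffOn_cB hΩ hG hE j))).add
    (hs _ (contDiffOn_cC hΩ hG hE j))

theorem isOpen_zpart_preimage {n : ℕ} {U : Set (Fin n → ℂ)} (hU : IsOpen U) :
    IsOpen (zpart ⁻¹' U : Set (Fin (n + 1) → ℂ)) := hU.preimage contDiff_zpart.continuous

theorem isOpen_cA_ne_zero (hΩ : IsOpen Ω) (hG : ContDiffOn ℝ ∞ G Ω) (hE : ContDiffOn ℝ ∞ E Ω) :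
    IsOpen {z | z ∈ Ω ∧ cA G E z ≠ 0} :=
  (contDiffOn_cA hΩ hG hE).continuousOn.isOpen_inter_preimage hΩ isOpen_compl_singleton

theorem isCRPoint_graph (hΩ : IsOpen Ω) (hG : ContDiffOn ℝ ∞ G Ω) (hE : ContDiffOn ℝ ∞ E Ω)
    {x : Fin (N + 1 + 1) → ℂ} (hx : x ∈ graphSet Ω G E) (hA : cA G E (zpart x) ≠ 0) :
    IsCRPoint (graphSet Ω G E) x := by
  have hopen := isOpen_zpart_preimage (isOpen_cA_ne_zero hΩ hG hE)
  filter_upwards [self_mem_nhdsWithin, mem_nhdsWithin_of_mem_nhds (hopen.mem_nhds ⟨hx.1, hA⟩)]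
    with y hy hyA
  rw [crDim_graph hΩ hG hE hy hyA.2, crDim_graph hΩ hG hE hx hA]

/-- Along a CR submanifold `S ⊆ M` of full CR dimension through a point with `A ≠ 0`, the fields
`L_j` are tangent to `S` near that point: the CR dimensions of `S` and `M` are locally constant and
agree. -/
theorem eventually_L_mem_complexTangent (hΩ : IsOpen Ω) (hG : ContDiffOn ℝ ∞ G Ω)
    (hE : ContDiffOn ℝ ∞ E Ω) {S : Set (Fin (N + 1 + 1) → ℂ)} (hSM : S ⊆ graphSet Ω G E)
    {q : Fin (N + 1 + 1) → ℂ} (hq : q ∈ S) (hA : cA G E (zpart q) ≠ 0) (hCR : IsCRPoint S q)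
    (hhol : holTangent S q = holTangent (graphSet Ω G E) q) :
    ∃ V, IsOpen V ∧ q ∈ V ∧ V ⊆ zpart ⁻¹' Ω ∧
      ∀ y ∈ S ∩ V, ∀ j, L G E j y ∈ complexTangent S y := by
  have hM := hSM hq
  have hopen := isOpen_zpart_preimage (isOpen_cA_ne_zero hΩ hG hE)
  obtain ⟨V, hV, hqV, hVS⟩ := mem_nhdsWithin.1 hCR
  refine ⟨V ∩ zpart ⁻¹' {z | z ∈ Ω ∧ cA G E z ≠ 0}, hV.inter hopen, ⟨hqV, hM.1, hA⟩,
    fun y hy => hy.2.1, ?_⟩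
  rintro y ⟨hyS, hyV, hyA⟩ j
  have h1 : crDim S y = crDim S q := hVS ⟨hyV, hyS⟩
  have h2 : crDim S q = N := by rw [crDim, hhol]; exact crDim_graph hΩ hG hE hM hA
  have h3 : holTangent S y = holTangent (graphSet Ω G E) y := by
    refine Submodule.eq_of_le_of_finrank_eq
      (inf_le_inf_right _ (complexTangent_mono hSM y)) ?_
    change crDim S y = crDim _ y
    rw [crDim_graph hΩ hG hE (hSM hyS) hyA.2, h1, h2]
  have h4 := L_mem_holTangent hΩ hG hE (hSM hyS) j
  rw [← h3] at h4
  exact h4.1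

end Fields

/-! ### Coefficients of the brackets -/

section Brackets

variable {N : ℕ} {G E : (Fin (N + 1) → ℂ) → ℝ} {Ω : Set (Fin (N + 1) → ℂ)}

/-- The vector with coefficients `l₁, …, l₆` with respect to
`∂/∂z̄_k, ∂/∂z̄_n, ∂/∂w̄, ∂/∂z_j, ∂/∂z_n, ∂/∂w`. -/
def coeffVec (j k : Fin N) (l₁ l₂ l₃ l₄ l₅ l₆ : ℂ) : CVec (Fin (N + 1 + 1)) :=
  (Pi.single j.castSucc.castSucc l₄ + Pi.single (Fin.last N).castSucc l₅
      + Pi.single (Fin.last (N + 1)) l₆,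
    Pi.single k.castSucc.castSucc l₁ + Pi.single (Fin.last N).castSucc l₂
      + Pi.single (Fin.last (N + 1)) l₃)

theorem L_eq_coeffVec (j k : Fin N) (x : Fin (N + 1 + 1) → ℂ) :
    L G E j x = coeffVec j k 0 0 0 (cA G E (zpart x)) (-cB G E j (zpart x))
      (cC G E j (zpart x)) := by
  simp [L, coeffVec, Pi.single_neg, sub_eq_add_neg]

theorem conj_single {κ : Type*} [DecidableEq κ] (k i : κ) (c : ℂ) :
    starRingEnd ℂ ((Pi.single k c : κ → ℂ) i) = (Pi.single k (starRingEnd ℂ c) : κ → ℂ) i := by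
  by_cases h : i = k
  · subst h; simp
  · simp [h]

theorem Lbar_eq_coeffVec (j k : Fin N) (x : Fin (N + 1 + 1) → ℂ) :
    Lbar G E k x = coeffVec j k (cAbar G E (zpart x)) (-cBbar G E k (zpart x))
      (cCbar G E k (zpart x)) 0 0 0 := by
  ext i
  · simp [Lbar_fst, coeffVec]
  · rw [Lbar_snd]
    simp [L, coeffVec, conj_single, Pi.single_neg, sub_eq_add_neg, cAbar, cBbar, cCbar]

theorem act_coeffVec_comp_zpart (j k : Fin N) (l₁ l₂ l₃ l₄ l₅ l₆ : ℂ) {x : Fin (N + 1 + 1) → ℂ}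
    {f : (Fin (N + 1) → ℂ) → ℂ} (hf : DifferentiableAt ℝ f (zpart x)) :
    act (coeffVec j k l₁ l₂ l₃ l₄ l₅ l₆) (fun y => f (zpart y)) x
      = l₄ * dz j.castSucc f (zpart x) + l₅ * dz (Fin.last N) f (zpart x)
        + (l₁ * dzbar k.castSucc f (zpart x) + l₂ * dzbar (Fin.last N) f (zpart x)) := by
  have hne : ∀ i : Fin N, Fin.last N ≠ i.castSucc := fun i => (Fin.castSucc_ne_last i).symm
  rw [act_comp_zpart _ hf]
  simp [act, zvec, coeffVec, Pi.single_apply, Fin.sum_univ_castSucc, add_mul, hne,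
    Fin.castSucc_ne_last, Fin.castSucc_inj]

theorem act_L (j : Fin N) {x : Fin (N + 1 + 1) → ℂ} {f : (Fin (N + 1) → ℂ) → ℂ}
    (hf : DifferentiableAt ℝ f (zpart x)) :
    act (L G E j x) (fun y => f (zpart y)) x = cA G E (zpart x) * dz j.castSucc f (zpart x)
      - cB G E j (zpart x) * dz (Fin.last N) f (zpart x) := by
  rw [L_eq_coeffVec j j, act_coeffVec_comp_zpart _ _ _ _ _ _ _ _ hf]
  ring

theorem act_Lbar (k : Fin N) {x : Fin (N + 1 + 1) → ℂ} {f : (Fin (N + 1) → ℂ) → ℂ}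
    (hf : DifferentiableAt ℝ f (zpart x)) :
    act (Lbar G E k x) (fun y => f (zpart y)) x
      = cAbar G E (zpart x) * dzbar k.castSucc f (zpart x)
        - cBbar G E k (zpart x) * dzbar (Fin.last N) f (zpart x) := by
  rw [Lbar_eq_coeffVec k k, act_coeffVec_comp_zpart _ _ _ _ _ _ _ _ hf]
  ring

/-- Differentiating along `v` the coefficients of a field `X` that near `x` has the six coefficients
`f₁, …, f₆`. -/
theorem act_coeff_of_eventually_eq (v : CVec (Fin (N + 1 + 1))) (j k : Fin N)
    {X : (Fin (N + 1 + 1) → ℂ) → CVec (Fin (N + 1 + 1))}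
    {f₁ f₂ f₃ f₄ f₅ f₆ : (Fin (N + 1 + 1) → ℂ) → ℂ} {x : Fin (N + 1 + 1) → ℂ}
    (hX : ∀ᶠ y in 𝓝 x, X y = coeffVec j k (f₁ y) (f₂ y) (f₃ y) (f₄ y) (f₅ y) (f₆ y))
    (h₁ : DifferentiableAt ℝ f₁ x) (h₂ : DifferentiableAt ℝ f₂ x) (h₃ : DifferentiableAt ℝ f₃ x)
    (h₄ : DifferentiableAt ℝ f₄ x) (h₅ : DifferentiableAt ℝ f₅ x) (h₆ : DifferentiableAt ℝ f₆ x) :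
    ((fun i => act v (fun y => (X y).1 i) x, fun i => act v (fun y => (X y).2 i) x) :
        CVec (Fin (N + 1 + 1)))
      = coeffVec j k (act v f₁ x) (act v f₂ x) (act v f₃ x) (act v f₄ x) (act v f₅ x)
          (act v f₆ x) := by
  have hs : ∀ (m i : Fin (N + 1 + 1)) {f : (Fin (N + 1 + 1) → ℂ) → ℂ}, DifferentiableAt ℝ f x →
      DifferentiableAt ℝ (fun y => (Pi.single m (f y) : Fin (N + 1 + 1) → ℂ) i) x ∧
      act v (fun y => (Pi.single m (f y) : Fin (N + 1 + 1) → ℂ) i) x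
        = (Pi.single m (act v f x) : Fin (N + 1 + 1) → ℂ) i := by
    intro m i f hf
    by_cases h : i = m
    · subst h; simpa using hf
    · simp [h, act_const]
  ext i
  · refine (act_congr (hX.mono fun y hy => by rw [hy])).trans ?_
    simp only [coeffVec, Pi.add_apply]
    rw [act_add ((hs _ i h₄).1.fun_add (hs _ i h₅).1) (hs _ i h₆).1,
      act_add (hs _ i h₄).1 (hs _ i h₅).1, (hs _ i h₄).2, (hs _ i h₅).2, (hs _ i h₆).2]
  · refine (act_congr (hX.mono fun y hy => by rw [hy])).trans ?_
    simp only [coeffVec, Pi.add_apply]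
    rw [act_add ((hs _ i h₁).1.fun_add (hs _ i h₂).1) (hs _ i h₃).1,
      act_add (hs _ i h₁).1 (hs _ i h₂).1, (hs _ i h₁).2, (hs _ i h₂).2, (hs _ i h₃).2]

theorem bracket_eq_sub {κ : Type*} [Fintype κ] [DecidableEq κ] (X Y : (κ → ℂ) → CVec κ)
    (x : κ → ℂ) :
    bracket X Y x
      = ((fun i => act (X x) (fun y => (Y y).1 i) x, fun i => act (X x) (fun y => (Y y).2 i) x) :
          CVec κ)
        - (fun i => act (Y x) (fun y => (X y).1 i) x, fun i => act (Y x) (fun y => (X y).2 i) x) :=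
  rfl

theorem coeffVec_sub (j k : Fin N) (l₁ l₂ l₃ l₄ l₅ l₆ m₁ m₂ m₃ m₄ m₅ m₆ : ℂ) :
    coeffVec j k l₁ l₂ l₃ l₄ l₅ l₆ - coeffVec j k m₁ m₂ m₃ m₄ m₅ m₆
      = coeffVec j k (l₁ - m₁) (l₂ - m₂) (l₃ - m₃) (l₄ - m₄) (l₅ - m₅) (l₆ - m₆) := by
  simp only [coeffVec, Prod.mk_sub_mk, Pi.single_sub]
  congr 1 <;> abel

theorem differentiableAt_comp_zpart {f : (Fin (N + 1) → ℂ) → ℂ} {x : Fin (N + 1 + 1) → ℂ}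
    (hf : DifferentiableAt ℝ f (zpart x)) : DifferentiableAt ℝ (fun y => f (zpart y)) x :=
  hf.fun_comp' x (contDiff_zpart.differentiable (by simp) x)

theorem bracket_L_Lbar (hΩ : IsOpen Ω) (hG : ContDiffOn ℝ ∞ G Ω) (hE : ContDiffOn ℝ ∞ E Ω)
    {x : Fin (N + 1 + 1) → ℂ} (hx : zpart x ∈ Ω) (j k : Fin N) :
    bracket (L G E j) (Lbar G E k) x
      = coeffVec j k (lam1 G E j k (zpart x)) (lam2 G E j k (zpart x)) (lam3 G E j k (zpart x))
          (lam4 G E j k (zpart x)) (lam5 G E j k (zpart x)) (lam6 G E j k (zpart x)) := by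
  have dA := differentiableAt_of_contDiffOn hΩ (contDiffOn_cA hΩ hG hE) hx
  have dB := fun j => differentiableAt_of_contDiffOn hΩ (contDiffOn_cB hΩ hG hE j) hx
  have dC := fun j => differentiableAt_of_contDiffOn hΩ (contDiffOn_cC hΩ hG hE j) hx
  have dA' : DifferentiableAt ℝ (cAbar G E) (zpart x) :=
    differentiableAt_of_contDiffOn hΩ (contDiffOn_conj (contDiffOn_cA hΩ hG hE)) hx
  have dB' : ∀ j, DifferentiableAt ℝ (cBbar G E j) (zpart x) := fun j =>
    differentiableAt_of_contDiffOn hΩ (contDiffOn_conj (contDiffOn_cB hΩ hG hE j)) hx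
  have dC' : ∀ j, DifferentiableAt ℝ (cCbar G E j) (zpart x) := fun j =>
    differentiableAt_of_contDiffOn hΩ (contDiffOn_conj (contDiffOn_cC hΩ hG hE j)) hx
  have d0 : DifferentiableAt ℝ (fun _ : Fin (N + 1 + 1) → ℂ => (0 : ℂ)) x :=
    differentiableAt_const _
  have e1 := act_coeff_of_eventually_eq (L G E j x) j k
    (Eventually.of_forall (Lbar_eq_coeffVec (G := G) (E := E) j k))
    (differentiableAt_comp_zpart dA') (differentiableAt_comp_zpart (dB' k)).fun_neg
    (differentiableAt_comp_zpart (dC' k)) d0 d0 d0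
  have e2 := act_coeff_of_eventually_eq (Lbar G E k x) j k
    (Eventually.of_forall (L_eq_coeffVec (G := G) (E := E) j k)) d0 d0 d0
    (differentiableAt_comp_zpart dA) (differentiableAt_comp_zpart (dB j)).fun_neg
    (differentiableAt_comp_zpart (dC j))
  rw [bracket_eq_sub, e1, e2, coeffVec_sub]
  simp only [act_const, act_neg, act_L j dA', act_L j (dB' k), act_L j (dC' k), act_Lbar k dA,
    act_Lbar k (dB j), act_Lbar k (dC j)]
  congr 1 <;> simp only [lam1, lam2, lam3, lam4, lam5, lam6] <;> ring

theorem contDiffOn_cAbar (hΩ : IsOpen Ω) (hG : ContDiffOn ℝ ∞ G Ω) (hE : ContDiffOn ℝ ∞ E Ω) :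
    ContDiffOn ℝ ∞ (cAbar G E) Ω := contDiffOn_conj (contDiffOn_cA hΩ hG hE)

theorem contDiffOn_cBbar (hΩ : IsOpen Ω) (hG : ContDiffOn ℝ ∞ G Ω) (hE : ContDiffOn ℝ ∞ E Ω)
    (j : Fin N) : ContDiffOn ℝ ∞ (cBbar G E j) Ω := contDiffOn_conj (contDiffOn_cB hΩ hG hE j)

theorem contDiffOn_cCbar (hΩ : IsOpen Ω) (hG : ContDiffOn ℝ ∞ G Ω) (hE : ContDiffOn ℝ ∞ E Ω)
    (j : Fin N) : ContDiffOn ℝ ∞ (cCbar G E j) Ω := contDiffOn_conj (contDiffOn_cC hΩ hG hE j)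

section Smooth

variable (hΩ : IsOpen Ω) (hG : ContDiffOn ℝ ∞ G Ω) (hE : ContDiffOn ℝ ∞ E Ω) (j k : Fin N)
include hΩ hG hE

theorem contDiffOn_lam1 : ContDiffOn ℝ ∞ (lam1 G E j k) Ω :=
  ((contDiffOn_cA hΩ hG hE).mul (contDiffOn_dz hΩ (contDiffOn_cAbar hΩ hG hE) _)).sub
    ((contDiffOn_cB hΩ hG hE j).mul (contDiffOn_dz hΩ (contDiffOn_cAbar hΩ hG hE) _))

theorem contDiffOn_lam2 : ContDiffOn ℝ ∞ (lam2 G E j k) Ω :=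
  ((contDiffOn_cA hΩ hG hE).mul (contDiffOn_dz hΩ (contDiffOn_cBbar hΩ hG hE k) _)).neg.add
    ((contDiffOn_cB hΩ hG hE j).mul (contDiffOn_dz hΩ (contDiffOn_cBbar hΩ hG hE k) _))

theorem contDiffOn_lam3 : ContDiffOn ℝ ∞ (lam3 G E j k) Ω :=
  ((contDiffOn_cA hΩ hG hE).mul (contDiffOn_dz hΩ (contDiffOn_cCbar hΩ hG hE k) _)).sub
    ((contDiffOn_cB hΩ hG hE j).mul (contDiffOn_dz hΩ (contDiffOn_cCbar hΩ hG hE k) _))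

theorem contDiffOn_lam4 : ContDiffOn ℝ ∞ (lam4 G E j k) Ω :=
  ((contDiffOn_cAbar hΩ hG hE).mul (contDiffOn_dzbar hΩ (contDiffOn_cA hΩ hG hE) _)).neg.add
    ((contDiffOn_cBbar hΩ hG hE k).mul (contDiffOn_dzbar hΩ (contDiffOn_cA hΩ hG hE) _))

theorem contDiffOn_lam5 : ContDiffOn ℝ ∞ (lam5 G E j k) Ω :=
  ((contDiffOn_cAbar hΩ hG hE).mul (contDiffOn_dzbar hΩ (contDiffOn_cB hΩ hG hE j) _)).sub
    ((contDiffOn_cBbar hΩ hG hE k).mul (contDiffOn_dzbar hΩ (contDiffOn_cB hΩ hG hE j) _))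

theorem contDiffOn_lam6 : ContDiffOn ℝ ∞ (lam6 G E j k) Ω :=
  ((contDiffOn_cAbar hΩ hG hE).mul (contDiffOn_dzbar hΩ (contDiffOn_cC hΩ hG hE j) _)).neg.add
    ((contDiffOn_cBbar hΩ hG hE k).mul (contDiffOn_dzbar hΩ (contDiffOn_cC hΩ hG hE j) _))

end Smooth

variable [NeZero N]

theorem T_eq_coeffVec (hΩ : IsOpen Ω) (hG : ContDiffOn ℝ ∞ G Ω) (hE : ContDiffOn ℝ ∞ E Ω)
    {x : Fin (N + 1 + 1) → ℂ} (hx : zpart x ∈ Ω) :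
    T G E x
      = coeffVec 0 0 (lam1 G E 0 0 (zpart x)) (lam2 G E 0 0 (zpart x)) (lam3 G E 0 0 (zpart x))
          (lam4 G E 0 0 (zpart x)) (lam5 G E 0 0 (zpart x)) (lam6 G E 0 0 (zpart x)) :=
  bracket_L_Lbar hΩ hG hE hx 0 0

theorem act_T (hΩ : IsOpen Ω) (hG : ContDiffOn ℝ ∞ G Ω) (hE : ContDiffOn ℝ ∞ E Ω)
    {x : Fin (N + 1 + 1) → ℂ} (hx : zpart x ∈ Ω) {f : (Fin (N + 1) → ℂ) → ℂ}
    (hf : DifferentiableAt ℝ f (zpart x)) :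
    act (T G E x) (fun y => f (zpart y)) x = opT G E f (zpart x) := by
  rw [T_eq_coeffVec hΩ hG hE hx, act_coeffVec_comp_zpart _ _ _ _ _ _ _ _ hf, opT]
  ring

theorem bracket_L_T (hΩ : IsOpen Ω) (hG : ContDiffOn ℝ ∞ G Ω) (hE : ContDiffOn ℝ ∞ E Ω)
    {x : Fin (N + 1 + 1) → ℂ} (hx : zpart x ∈ Ω) :
    bracket (L G E 0) (T G E) x
      = coeffVec 0 0 (gam1 G E (zpart x)) (gam2 G E (zpart x)) (gam3 G E (zpart x))
          (gam4 G E (zpart x)) (gam5 G E (zpart x)) (gam6 G E (zpart x)) := by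
  have dA := differentiableAt_of_contDiffOn hΩ (contDiffOn_cA hΩ hG hE) hx
  have dB := differentiableAt_of_contDiffOn hΩ (contDiffOn_cB hΩ hG hE 0) hx
  have dC := differentiableAt_of_contDiffOn hΩ (contDiffOn_cC hΩ hG hE 0) hx
  have d1 := differentiableAt_of_contDiffOn hΩ (contDiffOn_lam1 hΩ hG hE 0 0) hx
  have d2 := differentiableAt_of_contDiffOn hΩ (contDiffOn_lam2 hΩ hG hE 0 0) hx
  have d3 := differentiableAt_of_contDiffOn hΩ (contDiffOn_lam3 hΩ hG hE 0 0) hx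
  have d4 := differentiableAt_of_contDiffOn hΩ (contDiffOn_lam4 hΩ hG hE 0 0) hx
  have d5 := differentiableAt_of_contDiffOn hΩ (contDiffOn_lam5 hΩ hG hE 0 0) hx
  have d6 := differentiableAt_of_contDiffOn hΩ (contDiffOn_lam6 hΩ hG hE 0 0) hx
  have d0 : DifferentiableAt ℝ (fun _ : Fin (N + 1 + 1) → ℂ => (0 : ℂ)) x :=
    differentiableAt_const _
  -- the formula for `T` holds only over `Ω`, hence as an equality of germs at `x`
  have hT : ∀ᶠ y in 𝓝 x, T G E y = coeffVec 0 0 (lam1 G E 0 0 (zpart y)) (lam2 G E 0 0 (zpart y))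
      (lam3 G E 0 0 (zpart y)) (lam4 G E 0 0 (zpart y)) (lam5 G E 0 0 (zpart y))
      (lam6 G E 0 0 (zpart y)) := by
    filter_upwards [(isOpen_zpart_preimage hΩ).mem_nhds hx] with y hy
    exact T_eq_coeffVec hΩ hG hE hy
  have e1 := act_coeff_of_eventually_eq (L G E 0 x) 0 0 hT (differentiableAt_comp_zpart d1)
    (differentiableAt_comp_zpart d2) (differentiableAt_comp_zpart d3)
    (differentiableAt_comp_zpart d4) (differentiableAt_comp_zpart d5)
    (differentiableAt_comp_zpart d6)
  have e2 := act_coeff_of_eventually_eq (T G E x) 0 0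
    (Eventually.of_forall (L_eq_coeffVec (G := G) (E := E) 0 0)) d0 d0 d0
    (differentiableAt_comp_zpart dA) (differentiableAt_comp_zpart dB).fun_neg
    (differentiableAt_comp_zpart dC)
  rw [bracket_eq_sub, e1, e2, coeffVec_sub]
  simp only [act_const, act_neg, act_L 0 d1, act_L 0 d2, act_L 0 d3, act_L 0 d4, act_L 0 d5,
    act_L 0 d6, act_T hΩ hG hE hx dA, act_T hΩ hG hE hx dB, act_T hΩ hG hE hx dC]
  congr 1 <;> simp only [gam1, gam2, gam3, gam5, opL1] <;> ring

end Brackets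

/-! ### Eliminating the fields `L_h` and `L̄_h` -/

section Elimination

variable {N : ℕ} [NeZero N] {G E : (Fin (N + 1) → ℂ) → ℝ} {Ω : Set (Fin (N + 1) → ℂ)}

/-- The linear form `v ↦ a v_i - ∑_h b_h v_h` on coefficient vectors. -/
def elimForm (a : ℂ) (b : Fin N → ℂ) (i : Fin (N + 1 + 1)) : (Fin (N + 1 + 1) → ℂ) →ₗ[ℂ] ℂ :=
  a • LinearMap.proj i - ∑ h, b h • LinearMap.proj h.castSucc.castSucc

theorem elimForm_last (a : ℂ) (b : Fin N → ℂ) (j : Fin N) (c d e : ℂ) :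
    elimForm a b (Fin.last (N + 1)) (Pi.single j.castSucc.castSucc c
      + Pi.single (Fin.last N).castSucc d + Pi.single (Fin.last (N + 1)) e) = a * e - b j * c := by
  have hne : ∀ i : Fin (N + 1), Fin.last (N + 1) ≠ i.castSucc :=
    fun i => (Fin.castSucc_ne_last i).symm
  simp [elimForm, Pi.single_apply, Fin.castSucc_inj, Fin.castSucc_ne_last, hne]

theorem elimForm_n (a : ℂ) (b : Fin N → ℂ) (j : Fin N) (c d e : ℂ) :
    elimForm a b (Fin.last N).castSucc (Pi.single j.castSucc.castSucc c
      + Pi.single (Fin.last N).castSucc d + Pi.single (Fin.last (N + 1)) e) = a * d - b j * c := by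
  have hne : ∀ i : Fin N, Fin.last N ≠ i.castSucc :=
    fun i => (Fin.castSucc_ne_last i).symm
  simp [elimForm, Pi.single_apply, Fin.castSucc_inj, Fin.castSucc_ne_last, hne]

/-- Modulo the `L_h` and `L̄_h`, a vector of the span is a multiple of `T`. -/
theorem exists_eq_mul_of_mem_spanLT {x : Fin (N + 1 + 1) → ℂ} {v : CVec (Fin (N + 1 + 1))}
    (hv : v ∈ spanLT G E x) :
    ∃ γ : ℂ, ∀ ψ : CVec (Fin (N + 1 + 1)) →ₗ[ℂ] ℂ, (∀ h, ψ (L G E h x) = 0) →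
      (∀ h, ψ (Lbar G E h x) = 0) → ψ v = γ * ψ (T G E x) := by
  rw [spanLT, Set.union_singleton, Submodule.mem_span_insert] at hv
  obtain ⟨γ, w, hw, rfl⟩ := hv
  refine ⟨γ, fun ψ h1 h2 => ?_⟩
  have hle : Submodule.span ℂ (Set.range (fun h => L G E h x) ∪ Set.range (fun h => Lbar G E h x))
      ≤ LinearMap.ker ψ := by
    rw [Submodule.span_le]
    rintro _ (⟨h, rfl⟩ | ⟨h, rfl⟩)
    · exact h1 h
    · exact h2 h
  rw [map_add, map_smul, LinearMap.mem_ker.1 (hle hw), smul_eq_mul, add_zero]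

/-- A vector of the span satisfies the four equations obtained from its expansion by eliminating
the coefficients of `L_h` and `L̄_h`. -/
theorem exists_system_of_mem_spanLT (hΩ : IsOpen Ω) (hG : ContDiffOn ℝ ∞ G Ω)
    (hE : ContDiffOn ℝ ∞ E Ω) {x : Fin (N + 1 + 1) → ℂ} (hx : zpart x ∈ Ω) {j k : Fin N}
    {l₁ l₂ l₃ l₄ l₅ l₆ : ℂ} (hv : coeffVec j k l₁ l₂ l₃ l₄ l₅ l₆ ∈ spanLT G E x) {z}
    (hz : zpart x = z) :
    ∃ γ : ℂ,
      (cAbar G E z * lam2 G E 0 0 z + cBbar G E 0 z * lam1 G E 0 0 z) * γ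
        = cAbar G E z * l₂ + l₁ * cBbar G E k z ∧
      (cAbar G E z * lam3 G E 0 0 z - cCbar G E 0 z * lam1 G E 0 0 z) * γ
        = cAbar G E z * l₃ - l₁ * cCbar G E k z ∧
      (cA G E z * lam5 G E 0 0 z + cB G E 0 z * lam4 G E 0 0 z) * γ
        = cA G E z * l₅ + l₄ * cB G E j z ∧
      (cA G E z * lam6 G E 0 0 z - cC G E 0 z * lam4 G E 0 0 z) * γ
        = cA G E z * l₆ - l₄ * cC G E j z := by
  obtain ⟨γ, hγ⟩ := exists_eq_mul_of_mem_spanLT hv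
  subst hz
  have hT := T_eq_coeffVec hΩ hG hE hx
  have key : ∀ ψ : CVec (Fin (N + 1 + 1)) →ₗ[ℂ] ℂ, (∀ h, ψ (L G E h x) = 0) →
      (∀ h, ψ (Lbar G E h x) = 0) → ψ (coeffVec j k l₁ l₂ l₃ l₄ l₅ l₆)
        = γ * ψ (coeffVec 0 0 (lam1 G E 0 0 (zpart x)) (lam2 G E 0 0 (zpart x))
          (lam3 G E 0 0 (zpart x)) (lam4 G E 0 0 (zpart x)) (lam5 G E 0 0 (zpart x))
          (lam6 G E 0 0 (zpart x))) := by
    rw [← hT]; exact hγ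
  have k2 := key
    (elimForm (cAbar G E (zpart x)) (fun h => -cBbar G E h (zpart x)) (Fin.last N).castSucc ∘ₗ
      LinearMap.snd ℂ _ _)
    (fun h => by
      simp only [L_eq_coeffVec h h, LinearMap.comp_apply, LinearMap.snd_apply, coeffVec, elimForm_n]
      ring)
    (fun h => by
      simp only [Lbar_eq_coeffVec h h, LinearMap.comp_apply, LinearMap.snd_apply, coeffVec,
        elimForm_n]
      ring)
  have k3 := key
    (elimForm (cAbar G E (zpart x)) (fun h => cCbar G E h (zpart x)) (Fin.last (N + 1)) ∘ₗ
      LinearMap.snd ℂ _ _)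
    (fun h => by
      simp only [L_eq_coeffVec h h, LinearMap.comp_apply, LinearMap.snd_apply, coeffVec,
        elimForm_last]
      ring)
    (fun h => by
      simp only [Lbar_eq_coeffVec h h, LinearMap.comp_apply, LinearMap.snd_apply, coeffVec,
        elimForm_last]
      ring)
  have k5 := key
    (elimForm (cA G E (zpart x)) (fun h => -cB G E h (zpart x)) (Fin.last N).castSucc ∘ₗ
      LinearMap.fst ℂ _ _)
    (fun h => by
      simp only [L_eq_coeffVec h h, LinearMap.comp_apply, LinearMap.fst_apply, coeffVec, elimForm_n]
      ring)
    (fun h => by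
      simp only [Lbar_eq_coeffVec h h, LinearMap.comp_apply, LinearMap.fst_apply, coeffVec,
        elimForm_n]
      ring)
  have k6 := key
    (elimForm (cA G E (zpart x)) (fun h => cC G E h (zpart x)) (Fin.last (N + 1)) ∘ₗ
      LinearMap.fst ℂ _ _)
    (fun h => by
      simp only [L_eq_coeffVec h h, LinearMap.comp_apply, LinearMap.fst_apply, coeffVec,
        elimForm_last]
      ring)
    (fun h => by
      simp only [Lbar_eq_coeffVec h h, LinearMap.comp_apply, LinearMap.fst_apply, coeffVec,
        elimForm_last]
      ring)
  simp only [LinearMap.comp_apply, LinearMap.fst_apply, LinearMap.snd_apply, coeffVec, elimForm_n,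
    elimForm_last] at k2 k3 k5 k6
  exact ⟨γ, by linear_combination -k2, by linear_combination -k3, by linear_combination -k5,
    by linear_combination -k6⟩

/-- `A` times the coefficient of `∂/∂z_n` left in `T` after eliminating `L_1`. Where it does not
vanish, `T` is independent of the `L_h` and `L̄_h`. -/
noncomputable def leviCoeff (G E : (Fin (N + 1) → ℂ) → ℝ) (z : Fin (N + 1) → ℂ) : ℂ :=
  cA G E z * lam5 G E 0 0 z + cB G E 0 z * lam4 G E 0 0 z

theorem two_mul_add_one_le_finrank_spanLT (hΩ : IsOpen Ω) (hG : ContDiffOn ℝ ∞ G Ω)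
    (hE : ContDiffOn ℝ ∞ E Ω) {x : Fin (N + 1 + 1) → ℂ} (hx : zpart x ∈ Ω)
    (hA : cA G E (zpart x) ≠ 0) (hR : leviCoeff G E (zpart x) ≠ 0) :
    2 * N + 1 ≤ Module.finrank ℂ (spanLT G E x) := by
  set W : Submodule ℂ (CVec (Fin (N + 1 + 1))) :=
    Submodule.span ℂ (Set.range (fun h => L G E h x) ∪ Set.range (fun h => Lbar G E h x)) with hW
  have h1 : Module.finrank ℂ W = 2 * N := by
    rw [hW, ← Set.Sum.elim_range]
    refine (finrank_span_eq_card (linearIndependent_L_Lbar hA)).trans ?_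
    rw [Fintype.card_sum, Fintype.card_fin, two_mul]
  have h2 : W < spanLT G E x := by
    refine lt_of_le_of_ne (Submodule.span_mono Set.subset_union_left) fun h => hR ?_
    have hT : T G E x ∈ W := h ▸ Submodule.subset_span (Or.inr rfl)
    -- the linear form that computes `leviCoeff` from `T` vanishes on all `L_h` and `L̄_h`
    let ψ : CVec (Fin (N + 1 + 1)) →ₗ[ℂ] ℂ :=
      elimForm (cA G E (zpart x)) (fun h => -cB G E h (zpart x)) (Fin.last N).castSucc ∘ₗ
        LinearMap.fst ℂ _ _
    have hle : W ≤ LinearMap.ker ψ := by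
      rw [hW, Submodule.span_le]
      rintro _ (⟨h, rfl⟩ | ⟨h, rfl⟩)
      · change ψ _ = 0
        simp only [ψ, L_eq_coeffVec h h, LinearMap.comp_apply, LinearMap.fst_apply, coeffVec,
          elimForm_n]
        ring
      · change ψ _ = 0
        simp only [ψ, Lbar_eq_coeffVec h h, LinearMap.comp_apply, LinearMap.fst_apply, coeffVec,
          elimForm_n]
        ring
    have h3 : ψ (T G E x) = 0 := hle hT
    simp only [ψ, T_eq_coeffVec hΩ hG hE hx, LinearMap.comp_apply, LinearMap.fst_apply, coeffVec,
      elimForm_n] at h3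
    rw [leviCoeff]
    linear_combination h3
  have := Submodule.finrank_lt_finrank_of_lt h2
  omega

/-- At a non-minimal point where `leviCoeff` does not vanish, the span of the `L_h`, `L̄_h` and
`T` is already the whole tangent space of the CR submanifold `S`, which contains all brackets. -/
theorem bracket_mem_spanLT (hΩ : IsOpen Ω) (hG : ContDiffOn ℝ ∞ G Ω) (hE : ContDiffOn ℝ ∞ E Ω)
    {q : Fin (N + 1 + 1) → ℂ} (hA : cA G E (zpart q) ≠ 0) (hR : leviCoeff G E (zpart q) ≠ 0)
    (hq : IsNonminimalAt (graphSet Ω G E) (2 * (N + 1)) q) :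
    (∀ j k : Fin N, bracket (L G E j) (Lbar G E k) q ∈ spanLT G E q) ∧
      bracket (L G E 0) (T G E) q ∈ spanLT G E q := by
  obtain ⟨S, d, hd, hSM, hqS, hS, hCR, hhol⟩ := hq
  obtain ⟨V, hV, hqV, hVΩ, hL⟩ :=
    eventually_L_mem_complexTangent hΩ hG hE hSM hqS hA (hCR q hqS) hhol
  have hLb : ∀ y ∈ S ∩ V, ∀ j, Lbar G E j y ∈ complexTangent S y := fun y hy j =>
    conj_mem_complexTangent (hL y hy j)
  have sL := fun j => (contDiffOn_L hΩ hG hE j).mono hVΩ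
  have sLb : ∀ j, ContDiffOn ℝ ∞ (Lbar G E j) V := fun j => contDiffOn_conjField (sL j)
  have sT : ContDiffOn ℝ ∞ (T G E) V := contDiffOn_bracket hV (sL 0) (sLb 0)
  have hb : ∀ y ∈ S ∩ V, ∀ j k, bracket (L G E j) (Lbar G E k) y ∈ complexTangent S y :=
    fun y hy j k => bracket_mem_complexTangent hV (sL j) (sLb k) (fun x hx => hL x hx j)
      (fun x hx => hLb x hx k) hy
  have hT : ∀ y ∈ S ∩ V, T G E y ∈ complexTangent S y := fun y hy => hb y hy 0 0
  have hLT := bracket_mem_complexTangent hV (sL 0) sT (fun x hx => hL x hx 0) hT ⟨hqS, hqV⟩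
  have hle : spanLT G E q ≤ complexTangent S q := by
    rw [spanLT, Submodule.span_le]
    rintro _ ((⟨h, rfl⟩ | ⟨h, rfl⟩) | rfl)
    · exact hL q ⟨hqS, hqV⟩ h
    · exact hLb q ⟨hqS, hqV⟩ h
    · exact hT q ⟨hqS, hqV⟩
  have heq : spanLT G E q = complexTangent S q := by
    refine Submodule.eq_of_le_of_finrank_le hle ?_
    have h1 := finrank_complexTangent_le hS hqS
    have h2 := two_mul_add_one_le_finrank_spanLT hΩ hG hE (hVΩ hqV) hA hR
    omega
  rw [heq]
  exact ⟨hb q ⟨hqS, hqV⟩, hLT⟩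

end Elimination

/-! ### Second derivatives at the origin -/

section Origin

theorem rdz_quadric {n : ℕ} (μ : Fin n → ℝ) (i : Fin n) (z : Fin n → ℂ) :
    rdz i (quadric μ) z = starRingEnd ℂ (z i) + 2 * μ i * z i := by
  have h : (fun y : Fin n → ℂ => (quadric μ y : ℂ)) = fun y => ∑ k, (y k * starRingEnd ℂ (y k)
      + μ k * (y k * y k + starRingEnd ℂ (y k) * starRingEnd ℂ (y k))) := by
    ext y
    simp only [quadric, Complex.ofReal_sum]
    refine Finset.sum_congr rfl fun k _ => ?_
    apply Complex.ext
    · rw [Complex.ofReal_re, Complex.sq_norm, Complex.normSq_apply]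
      simp [pow_two]
    · simp [pow_two]; ring_nf
  rw [rdz, h, dz_eq_act, act_sum _ (fun k _ => by fun_prop)]
  have hk : ∀ k : Fin n, act (Pi.single i 1, 0) (fun y : Fin n → ℂ => y k * starRingEnd ℂ (y k)
      + μ k * (y k * y k + starRingEnd ℂ (y k) * starRingEnd ℂ (y k))) z
      = if k = i then starRingEnd ℂ (z i) + 2 * μ i * z i else 0 := by
    intro k
    rw [act_add (by fun_prop) (by fun_prop), act_mul (by fun_prop) (by fun_prop),
      act_const_mul _ (by fun_prop), act_add (by fun_prop) (by fun_prop),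
      act_mul (by fun_prop) (by fun_prop), act_mul (by fun_prop) (by fun_prop), act_coord,
      act_conj_coord]
    by_cases hki : k = i
    · subst hki; simp; ring
    · simp [hki]
  simp [hk]

theorem dzbar_rdz_eq_zero {n : ℕ} {Ω : Set (Fin n → ℂ)} (hΩ : IsOpen Ω) (h0 : 0 ∈ Ω)
    {f : (Fin n → ℂ) → ℝ} (hf : ContDiffOn ℝ ∞ f Ω) (hf3 : OrdGE f 3) (i k : Fin n) :
    dzbar k (rdz i f) 0 = 0 := by
  have hf2 : ContDiffAt ℝ 2 f 0 :=
    (hf.contDiffAt (hΩ.mem_nhds h0)).of_le (WithTop.coe_le_coe.2 le_top)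
  have hc2 : ContDiffAt ℝ 2 (fun y => (f y : ℂ)) 0 :=
    Complex.ofRealCLM.contDiff.contDiffAt.comp 0 hf2
  have h2 : iteratedFDeriv ℝ 2 (fun y => (f y : ℂ)) 0 = 0 := by
    have h := Complex.ofRealCLM.iteratedFDeriv_comp_left hf2 (i := 2) le_rfl
    rw [hf3 2 (by norm_num)] at h
    refine h.trans ?_
    ext m
    simp
  have h3 : ∀ a b, fderiv ℝ (fderiv ℝ fun y => (f y : ℂ)) 0 a b = 0 := by
    intro a b
    have h := iteratedFDeriv_two_apply (𝕜 := ℝ) (fun y => (f y : ℂ)) 0 ![a, b]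
    rw [h2] at h
    simpa using h.symm
  have h4 : rdz i f = fun y => act (Pi.single i 1, 0) (fun y => (f y : ℂ)) y := by
    ext y; rw [rdz, dz_eq_act]
  rw [dzbar_eq_act, h4, act_eq, fderiv_act _ hc2, fderiv_act _ hc2]
  simp [h3]

/-- The mixed second derivatives of `G - √-1 E` at the origin are those of `∑ |z_i|²`. -/
theorem dzbar_rdz_sub_origin {n : ℕ} {Ω : Set (Fin n → ℂ)} (hΩ : IsOpen Ω) (h0 : 0 ∈ Ω)
    {p E G : (Fin n → ℂ) → ℝ} {μ : Fin n → ℝ} (hp : ContDiffOn ℝ ∞ p Ω)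
    (hE : ContDiffOn ℝ ∞ E Ω) (hp3 : OrdGE p 3) (hE3 : OrdGE E 3)
    (hG : ∀ z, G z = quadric μ z + p z) (hGs : ContDiffOn ℝ ∞ G Ω) (i k : Fin n) :
    dzbar k (fun z => rdz i G z - Complex.I * rdz i E z) 0 = if k = i then 1 else 0 := by
  have dr : ∀ {f : (Fin n → ℂ) → ℝ}, ContDiffOn ℝ ∞ f Ω → DifferentiableAt ℝ (rdz i f) 0 :=
    fun hf => differentiableAt_of_contDiffOn hΩ (contDiffOn_dz hΩ (contDiffOn_ofReal hf) i) h0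
  have hq : ContDiffOn ℝ ∞ (quadric μ) Ω := by
    have : quadric μ = fun z => G z - p z := by ext z; rw [hG]; ring
    rw [this]; exact hGs.sub hp
  have hsum : rdz i G =ᶠ[𝓝 0] fun z => rdz i (quadric μ) z + rdz i p z := by
    filter_upwards [hΩ.mem_nhds h0] with z hz
    have h1 : (fun y => (G y : ℂ)) = fun y => (quadric μ y : ℂ) + (p y : ℂ) := by
      ext y; rw [hG]; push_cast; rfl
    rw [rdz, h1, dz_eq_act, act_add (differentiableAt_of_contDiffOn hΩ (contDiffOn_ofReal hq) hz)
      (differentiableAt_of_contDiffOn hΩ (contDiffOn_ofReal hp) hz), rdz, rdz, dz_eq_act, dz_eq_act]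
  have hquad : dzbar k (rdz i (quadric μ)) 0 = if k = i then 1 else 0 := by
    have h1 : rdz i (quadric μ) = fun z => starRingEnd ℂ (z i) + 2 * μ i * z i := by
      ext z; exact rdz_quadric μ i z
    rw [h1, dzbar_eq_act, act_add (by fun_prop) (by fun_prop), act_const_mul _ (by fun_prop),
      act_coord, act_conj_coord]
    simp [Pi.single_apply, eq_comm]
  rw [dzbar_eq_act, act_sub (dr hGs) ((dr hE).const_mul _), act_const_mul _ (dr hE),
    act_congr hsum, act_add (dr hq) (dr hp), ← dzbar_eq_act, ← dzbar_eq_act, ← dzbar_eq_act, hquad,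
    dzbar_rdz_eq_zero hΩ h0 hp hp3, dzbar_rdz_eq_zero hΩ h0 hE hE3]
  simp

/-- A small perturbation of the Hermitian form `|a|² + |b|²` is definite. -/
theorem eq_zero_of_perturbed_norm_sq {a b p q r s : ℂ} (hp : ‖p - 1‖ < 1 / 4) (hq : ‖q‖ < 1 / 4)
    (hr : ‖r‖ < 1 / 4) (hs : ‖s - 1‖ < 1 / 4)
    (h : a * starRingEnd ℂ a * p - a * starRingEnd ℂ b * q - b * starRingEnd ℂ a * r
      + b * starRingEnd ℂ b * s = 0) : a = 0 := by
  have h1 : ((‖a‖ ^ 2 + ‖b‖ ^ 2 : ℝ) : ℂ) = -(a * starRingEnd ℂ a * (p - 1))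
      + a * starRingEnd ℂ b * q + b * starRingEnd ℂ a * r - b * starRingEnd ℂ b * (s - 1) := by
    push_cast
    rw [← Complex.mul_conj', ← Complex.mul_conj']
    linear_combination h
  have h2 : ‖a‖ ^ 2 + ‖b‖ ^ 2 ≤ ‖a‖ * ‖a‖ * ‖p - 1‖ + ‖a‖ * ‖b‖ * ‖q‖ + ‖b‖ * ‖a‖ * ‖r‖
      + ‖b‖ * ‖b‖ * ‖s - 1‖ := by
    have h3 : ‖((‖a‖ ^ 2 + ‖b‖ ^ 2 : ℝ) : ℂ)‖ = ‖a‖ ^ 2 + ‖b‖ ^ 2 := by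
      rw [Complex.norm_real, Real.norm_of_nonneg (by positivity)]
    rw [← h3, h1]
    refine (norm_sub_le _ _).trans (add_le_add ((norm_add_le _ _).trans (add_le_add
      ((norm_add_le _ _).trans (add_le_add ?_ ?_)) ?_)) ?_) <;> simp
  have ha := norm_nonneg a
  have hb := norm_nonneg b
  have t1 : ‖a‖ * ‖a‖ * ‖p - 1‖ ≤ ‖a‖ * ‖a‖ * (1 / 4) := by gcongr
  have t2 : ‖a‖ * ‖b‖ * ‖q‖ ≤ ‖a‖ * ‖b‖ * (1 / 4) := by gcongr
  have t3 : ‖b‖ * ‖a‖ * ‖r‖ ≤ ‖b‖ * ‖a‖ * (1 / 4) := by gcongr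
  have t4 : ‖b‖ * ‖b‖ * ‖s - 1‖ ≤ ‖b‖ * ‖b‖ * (1 / 4) := by gcongr
  have t5 : ‖a‖ ^ 2 ≤ 0 := by nlinarith [sq_nonneg (‖a‖ - ‖b‖), sq_nonneg ‖b‖]
  exact norm_eq_zero.1 (pow_eq_zero_iff two_ne_zero |>.1 (le_antisymm t5 (sq_nonneg _)))

variable {N : ℕ} [NeZero N] {G E : (Fin (N + 1) → ℂ) → ℝ} {Ω : Set (Fin (N + 1) → ℂ)}

/-- Near the origin `A_n̄ ≠ 0`, and `T` is independent of the `L_h` and `L̄_h` wherever `A ≠ 0`. -/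
theorem exists_nhds_leviCoeff_ne_zero (hΩ : IsOpen Ω) (h0 : 0 ∈ Ω)
    {p : (Fin (N + 1) → ℂ) → ℝ} {μ : Fin (N + 1) → ℝ} (hp : ContDiffOn ℝ ∞ p Ω)
    (hE : ContDiffOn ℝ ∞ E Ω) (hp3 : OrdGE p 3) (hE3 : OrdGE E 3)
    (hG : ∀ z, G z = quadric μ z + p z) (hGs : ContDiffOn ℝ ∞ G Ω) :
    ∃ Ω', IsOpen Ω' ∧ (0 : Fin (N + 1) → ℂ) ∈ Ω' ∧ Ω' ⊆ Ω ∧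
      ∀ z ∈ Ω', dzbar (Fin.last N) (cA G E) z ≠ 0 ∧
        (cA G E z ≠ 0 → leviCoeff G E z ≠ 0) := by
  have val := dzbar_rdz_sub_origin hΩ h0 hp hE hp3 hE3 hG hGs
  have cont : ∀ (f : (Fin (N + 1) → ℂ) → ℂ) (k : Fin (N + 1)), ContDiffOn ℝ ∞ f Ω →
      ∀ c : ℂ, dzbar k f 0 = c → ∀ᶠ z in 𝓝 0, ‖dzbar k f z - c‖ < 1 / 4 := by
    intro f k hf c hc
    have h1 : ContinuousAt (dzbar k f) 0 :=
      (contDiffOn_dzbar hΩ hf k).continuousOn.continuousAt (hΩ.mem_nhds h0)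
    have h2 := Metric.continuousAt_iff'.1 h1 (1 / 4) (by norm_num)
    simpa [dist_eq_norm, hc] using h2
  have sA := contDiffOn_cA hΩ hGs hE
  have sB := contDiffOn_cB hΩ hGs hE 0
  have vAn : dzbar (Fin.last N) (cA G E) 0 = 1 := (val _ _).trans (if_pos rfl)
  have vA1 : dzbar (0 : Fin N).castSucc (cA G E) 0 = 0 :=
    (val _ _).trans (if_neg (Fin.castSucc_ne_last _))
  have vBn : dzbar (Fin.last N) (cB G E 0) 0 = 0 :=
    (val _ _).trans (if_neg (Fin.castSucc_ne_last _).symm)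
  have vB1 : dzbar (0 : Fin N).castSucc (cB G E 0) 0 = 1 := (val _ _).trans (if_pos rfl)
  have hev := (((cont _ _ sA _ vAn).and (cont _ _ sA _ vA1)).and
    ((cont _ _ sB _ vBn).and (cont _ _ sB _ vB1))).and (hΩ.mem_nhds h0)
  obtain ⟨Ω', hsub, hopen, h0'⟩ := eventually_nhds_iff.1 hev
  refine ⟨Ω', hopen, h0', fun z hz => (hsub z hz).2, fun z hz => ?_⟩
  obtain ⟨⟨⟨h1, h2⟩, h3, h4⟩, -⟩ := hsub z hz
  rw [sub_zero] at h2 h3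
  constructor
  · intro h
    rw [h] at h1
    norm_num at h1
  · intro hA hR
    refine hA (eq_zero_of_perturbed_norm_sq (b := cB G E 0 z) h4 h3 h2 h1 ?_)
    rw [← hR, leviCoeff, lam5, lam4, cAbar, cBbar]
    ring

end Origin

/-! ### Density of the points with `A ≠ 0` -/

section Density

variable {N : ℕ} [NeZero N] {G E : (Fin (N + 1) → ℂ) → ℝ} {Ω : Set (Fin (N + 1) → ℂ)}

theorem frequently_ne_zero_of_dzbar_ne_zero {n : ℕ} {f : (Fin n → ℂ) → ℂ} {z : Fin n → ℂ}
    {k : Fin n} (h : dzbar k f z ≠ 0) : ∃ᶠ y in 𝓝 z, f y ≠ 0 := by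
  intro hev
  refine h ?_
  have h1 : f =ᶠ[𝓝 z] fun _ => 0 := hev.mono fun y hy => not_not.1 hy
  rw [dzbar_eq_act, act_congr h1, act_const]

theorem eq_of_frequently_eq {X Y : Type*} [TopologicalSpace X] [TopologicalSpace Y] [T2Space Y]
    {f g : X → Y} {x : X} (hf : ContinuousAt f x) (hg : ContinuousAt g x)
    (h : ∃ᶠ y in 𝓝 x, f y = g y) : f x = g x := by
  by_contra hne
  exact h ((hf.prodMk hg).eventually (isClosed_diagonal.isOpen_compl.mem_nhds hne))

/-- The identities follow from the solvability of the systems at nearby points by eliminating the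
unknown and passing to the limit. -/
theorem identities_of_frequently (hΩ : IsOpen Ω) (hG : ContDiffOn ℝ ∞ G Ω)
    (hE : ContDiffOn ℝ ∞ E Ω) {z : Fin (N + 1) → ℂ} (hz : z ∈ Ω)
    (h : ∃ᶠ y in 𝓝 z, (∀ j k : Fin N, ∃ γ : ℂ, SystemGamma G E j k y γ) ∧
      (∀ k : Fin N, ∃ γ : ℂ, SystemGammaHat G E k y γ) ∧ ∃ τ : ℂ, SystemTau G E y τ) :
    (∀ j k : Fin N, IdentityGamma G E j k z) ∧ (∀ k : Fin N, IdentityGammaHat G E k z) ∧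
      IdentityTau G E z := by
  have ct : ∀ {f : (Fin (N + 1) → ℂ) → ℂ}, ContDiffOn ℝ ∞ f Ω → ContinuousAt f z := fun hf =>
    hf.continuousOn.continuousAt (hΩ.mem_nhds hz)
  have cA' := ct (contDiffOn_cA hΩ hG hE)
  have cAb := ct (contDiffOn_cAbar hΩ hG hE)
  have cBb := fun k => ct (contDiffOn_cBbar hΩ hG hE k)
  have cC' := fun k => ct (contDiffOn_cC hΩ hG hE k)
  have cCb := fun k => ct (contDiffOn_cCbar hΩ hG hE k)
  have c1 := fun j k => ct (contDiffOn_lam1 hΩ hG hE j k)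
  have c2 := fun j k => ct (contDiffOn_lam2 hΩ hG hE j k)
  have c3 := fun j k => ct (contDiffOn_lam3 hΩ hG hE j k)
  have c4 := fun j k => ct (contDiffOn_lam4 hΩ hG hE j k)
  have c6 := fun j k => ct (contDiffOn_lam6 hΩ hG hE j k)
  have cop : ∀ {f : (Fin (N + 1) → ℂ) → ℂ}, ContDiffOn ℝ ∞ f Ω → ContinuousAt (opL1 G E f) z :=
    fun hf => ct (((contDiffOn_cA hΩ hG hE).mul (contDiffOn_dz hΩ hf _)).sub
      ((contDiffOn_cB hΩ hG hE 0).mul (contDiffOn_dz hΩ hf _)))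
  have g1 : ContinuousAt (gam1 G E) z := cop (contDiffOn_lam1 hΩ hG hE 0 0)
  have g2 : ContinuousAt (gam2 G E) z := cop (contDiffOn_lam2 hΩ hG hE 0 0)
  have g3 : ContinuousAt (gam3 G E) z := cop (contDiffOn_lam3 hΩ hG hE 0 0)
  have key : ∀ j k : Fin N, IdentityGamma G E j k z := by
    intro j k
    refine eq_of_frequently_eq
      (((cAb.mul (c2 j k)).add ((cBb k).mul (c1 j k))).mul
        ((cA'.mul (c6 0 0)).sub ((cC' 0).mul (c4 0 0))))
      (((cAb.mul (c2 0 0)).add ((cBb 0).mul (c1 0 0))).mul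
        ((cA'.mul (c6 j k)).sub ((cC' j).mul (c4 j k)))) (h.mono ?_)
    rintro y ⟨hy, -, -⟩
    obtain ⟨γ, e2, -, -, e6⟩ := hy j k
    simp only [Pi.mul_apply, Pi.add_apply, Pi.sub_apply]
    linear_combination
      (cAbar G E y * lam2 G E 0 0 y + cBbar G E 0 y * lam1 G E 0 0 y) * e6
        - (cA G E y * lam6 G E 0 0 y - cC G E 0 y * lam4 G E 0 0 y) * e2
  refine ⟨key, fun k => key 0 k, ?_⟩
  refine eq_of_frequently_eq
    (((cAb.mul g2).add (g1.mul (cBb 0))).mul ((cAb.mul (c3 0 0)).sub ((c1 0 0).mul (cCb 0))))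
    (((cAb.mul g3).sub (g1.mul (cCb 0))).mul ((cAb.mul (c2 0 0)).add ((c1 0 0).mul (cBb 0))))
    (h.mono ?_)
  rintro y ⟨-, -, τ, e2, e3, -, -⟩
  simp only [Pi.mul_apply, Pi.add_apply, Pi.sub_apply]
  linear_combination
    (cAbar G E y * lam2 G E 0 0 y + lam1 G E 0 0 y * cBbar G E 0 y) * e3
      - (cAbar G E y * lam3 G E 0 0 y - lam1 G E 0 0 y * cCbar G E 0 y) * e2

end Density

end CRFlat

theorem proposition2p2 {N : ℕ} [NeZero N]
    (μ : Fin (N + 1) → ℝ) (hμ : ∀ i, 0 ≤ μ i)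
    (Ω : Set (Fin (N + 1) → ℂ)) (hΩ : IsOpen Ω) (h0 : (0 : Fin (N + 1) → ℂ) ∈ Ω)
    (p E G : (Fin (N + 1) → ℂ) → ℝ)
    (hp : ContDiffOn ℝ ∞ p Ω) (hE : ContDiffOn ℝ ∞ E Ω)
    (hp3 : CRFlat.OrdGE p 3) (hE3 : CRFlat.OrdGE E 3)
    (hG : ∀ z, G z = CRFlat.quadric μ z + p z)
    (M : Set (Fin (N + 1 + 1) → ℂ)) (hM : M = CRFlat.graphSet Ω G E)
    (hmin : ∀ᶠ x in 𝓝[M] 0, CRFlat.IsCRPoint M x → CRFlat.IsNonminimalAt M (2 * (N + 1)) x) :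
    ∃ U : Set (Fin (N + 1 + 1) → ℂ), IsOpen U ∧ 0 ∈ U ∧
      (∃ O : Set (Fin (N + 1 + 1) → ℂ),
        (∃ W : Set (Fin (N + 1 + 1) → ℂ), IsOpen W ∧ O = M ∩ W) ∧
        O ⊆ M ∩ U ∧ M ∩ U ⊆ closure O ∧
        ∀ x ∈ O,
          (∀ j k : Fin N,
            CRFlat.bracket (CRFlat.L G E j) (CRFlat.Lbar G E k) x ∈ CRFlat.spanLT G E x) ∧
          CRFlat.bracket (CRFlat.L G E 0) (CRFlat.T G E) x ∈ CRFlat.spanLT G E x ∧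
          (∀ j k : Fin N, ∃ γ : ℂ, CRFlat.SystemGamma G E j k (CRFlat.zpart x) γ) ∧
          (∀ k : Fin N, ∃ γ : ℂ, CRFlat.SystemGammaHat G E k (CRFlat.zpart x) γ) ∧
          (∃ τ : ℂ, CRFlat.SystemTau G E (CRFlat.zpart x) τ)) ∧
      ∀ x ∈ M ∩ U,
        (∀ j k : Fin N, CRFlat.IdentityGamma G E j k (CRFlat.zpart x)) ∧
        (∀ k : Fin N, CRFlat.IdentityGammaHat G E k (CRFlat.zpart x)) ∧
        CRFlat.IdentityTau G E (CRFlat.zpart x) := by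
  have hq : ContDiff ℝ ∞ (CRFlat.quadric μ) := by
    unfold CRFlat.quadric
    refine ContDiff.sum fun i _ => ?_
    have hi : ContDiff ℝ ∞ fun z : Fin (N + 1) → ℂ => z i := contDiff_apply ℝ ℂ i
    exact (hi.norm_sq ℝ).add (contDiff_const.mul (Complex.reCLM.contDiff.comp
      ((hi.pow 2).add ((Complex.conjCLE.contDiff.comp hi).pow 2))))
  have hGs : ContDiffOn ℝ ∞ G Ω := by
    have : G = fun z => CRFlat.quadric μ z + p z := funext hG
    rw [this]
    exact hq.contDiffOn.add hp
  obtain ⟨Ω', hΩ', h0', hsub, hloc⟩ :=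
    CRFlat.exists_nhds_leviCoeff_ne_zero hΩ h0 hp hE hp3 hE3 hG hGs
  obtain ⟨V, hV, h0V, hVM⟩ := mem_nhdsWithin.1 hmin
  subst hM
  set M := CRFlat.graphSet Ω G E
  set U : Set (Fin (N + 1 + 1) → ℂ) := V ∩ CRFlat.zpart ⁻¹' Ω' with hUdef
  have hU : IsOpen U := hV.inter (CRFlat.isOpen_zpart_preimage hΩ')
  set W : Set (Fin (N + 1 + 1) → ℂ) := U ∩ CRFlat.zpart ⁻¹' {z | z ∈ Ω ∧ CRFlat.cA G E z ≠ 0}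
  have hW : IsOpen W :=
    hU.inter (CRFlat.isOpen_zpart_preimage (CRFlat.isOpen_cA_ne_zero hΩ hGs hE))
  have hO : ∀ x ∈ M ∩ W,
      (∀ j k : Fin N,
        CRFlat.bracket (CRFlat.L G E j) (CRFlat.Lbar G E k) x ∈ CRFlat.spanLT G E x) ∧
      CRFlat.bracket (CRFlat.L G E 0) (CRFlat.T G E) x ∈ CRFlat.spanLT G E x ∧
      (∀ j k : Fin N, ∃ γ : ℂ, CRFlat.SystemGamma G E j k (CRFlat.zpart x) γ) ∧
      (∀ k : Fin N, ∃ γ : ℂ, CRFlat.SystemGammaHat G E k (CRFlat.zpart x) γ) ∧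
      (∃ τ : ℂ, CRFlat.SystemTau G E (CRFlat.zpart x) τ) := by
    rintro x ⟨hxM, ⟨hxV, hxΩ'⟩, -, hA⟩
    obtain ⟨hb, hbT⟩ := CRFlat.bracket_mem_spanLT hΩ hGs hE hA ((hloc _ hxΩ').2 hA)
      (hVM ⟨hxV, hxM⟩ (CRFlat.isCRPoint_graph hΩ hGs hE hxM hA))
    have hsys : ∀ j k : Fin N, ∃ γ : ℂ, CRFlat.SystemGamma G E j k (CRFlat.zpart x) γ :=
      fun j k => CRFlat.exists_system_of_mem_spanLT hΩ hGs hE hxM.1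
        (CRFlat.bracket_L_Lbar hΩ hGs hE hxM.1 j k ▸ hb j k) rfl
    refine ⟨hb, hbT, hsys, fun k => ?_, ?_⟩
    · obtain ⟨γ, e2, e3, e5, e6⟩ := hsys 0 k
      exact ⟨γ, by linear_combination e2, by linear_combination e3, by linear_combination e5,
        by linear_combination e6⟩
    · obtain ⟨τ, e2, e3, e5, e6⟩ := CRFlat.exists_system_of_mem_spanLT hΩ hGs hE hxM.1
        (CRFlat.bracket_L_T hΩ hGs hE hxM.1 ▸ hbT) rfl
      exact ⟨τ, by linear_combination e2, by linear_combination e3, by linear_combination e5,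
        by linear_combination e6⟩
  -- `A` vanishes on no open set over `Ω'`, so the graph meets `W` arbitrarily close to each point
  have hfreq : ∀ x ∈ M ∩ U, ContinuousAt (CRFlat.graphMap G E) (CRFlat.zpart x) ∧
      ∃ᶠ z in 𝓝 (CRFlat.zpart x), CRFlat.graphMap G E z ∈ M ∩ W := by
    rintro x ⟨hxM, hxU⟩
    have hc : ContinuousAt (CRFlat.graphMap G E) (CRFlat.zpart x) :=
      (CRFlat.contDiffOn_graphMap hGs hE).continuousOn.continuousAt (hΩ.mem_nhds hxM.1)
    refine ⟨hc, ?_⟩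
    have hU' : ∀ᶠ z in 𝓝 (CRFlat.zpart x), CRFlat.graphMap G E z ∈ U :=
      hc.preimage_mem_nhds (hU.mem_nhds (by rwa [CRFlat.graphMap_zpart hxM]))
    refine ((CRFlat.frequently_ne_zero_of_dzbar_ne_zero (hloc _ hxU.2).1).and_eventually
      (hU'.and (hΩ.mem_nhds hxM.1))).mono ?_
    rintro z ⟨hA, hzU, hzΩ⟩
    refine ⟨CRFlat.graphMap_mem hzΩ, hzU, ?_⟩
    rw [Set.mem_preimage, CRFlat.zpart_graphMap]
    exact ⟨hzΩ, hA⟩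
  refine ⟨U, hU, ⟨h0V, h0'⟩, ⟨M ∩ W, ⟨W, hW, rfl⟩, fun x hx => ⟨hx.1, hx.2.1⟩, ?_, hO⟩, ?_⟩
  · intro x hx
    obtain ⟨hc, hf⟩ := hfreq x hx
    have ht := hc.tendsto
    rw [CRFlat.graphMap_zpart hx.1] at ht
    exact mem_closure_iff_frequently.2 (ht.frequently hf)
  · intro x hx
    refine CRFlat.identities_of_frequently hΩ hGs hE hx.1.1 ((hfreq x hx).2.mono fun z hz => ?_)
    have h := hO _ hz
    rw [CRFlat.zpart_graphMap] at h
    exact h.2.2
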